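/- Let $k$ be a field of characteristic $p>0$ and let $G$ be a group of order $p^n$, $n\ge 0$. Let $\mathfrak{Ts}$ be the category of finitely generated commutative $k$-algebras $A$ on which $G$ acts by $k$-algebra automorphisms and which are trace-surjective, i.e. every invariant $a\in A^G$ is of the form $\mathrm{tr}(b)=\sum_{g\in G} g(b)$ with $b\in A$; morphisms are the $G$-equivariant $k$-algebra homomorphisms. An object $B$ is *universal* if every $A\in\mathfrak{Ts}$ admits a morphism $B\to A$; it is *minimal* if, for every $A\in\mathfrak{Ts}$, the existence of a monomorphism $A\to B$ implies the existence of a monomorphism $B\to A$; it is *basic* if it is universal and minimal. Let $D_k=k[X_g\mid g\in G]/(\sum_{g}X_g-1)\in\mathfrak{Ts}$, where $G$ permutes the $X_g$ regularly; $C\in\mathfrak{Ts}$ is *cyclic* if it is isomorphic to a quotient of $D_k$ by a $G$-stable ideal. A $G$-field is a field extension $K\ge k$ with a faithful action of $G$ by $k$-automorphisms; for such $K$ (and more generally for a commutative $k$-algebra $K$ with $G$-action) let $e_k(K)$ be the minimal transcendence degree over $k$ of a $G$-stable field $E$ with $k\le E\le K$ on which $G$ acts faithfully. The essential dimension of $G$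 is $e_k(G):=e_k(k(V^*))$, where $V$ is a faithful finite-dimensional $k$-representation of $G$ and $k(V^*)$ is the field of fractions of $\mathrm{Sym}_k(V^*)$. A $G$-field $K$ is *essential* if $\mathrm{tr.deg}_k K=e_k(G)=e_k(K)$. For $A\in\mathfrak{Ts}$ let $Q(A)$ be its total ring of quotients, put $k(\wp)=\mathrm{Quot}(A/\wp)$ for a $G$-stable prime $\wp$, and let $\mathcal S_A$ be the set of those $k(\wp)$, $\wp$ a $G$-stable prime of $A$, that admit a $G$-equivariant embedding of $k$-algebras $k(\wp)\hookrightarrow Q(A)$. Then: 1. Basic objects exist. All of them are integral domains, embed into $D_k$ by an injective morphism, and have the same finite Krull dimension $d_k(G)$. 2. Let $d_{\mathrm{dom},k}(G)$ be the minimum of the Krull dimensions of the integral domains in $\mathfrak{Ts}$; it is also the minimum over the cyclic integral domains in $\mathfrak{Ts}$. For $e_k(G)$ computed from any faithful finite-dimensional representation $V$, $$n\ \ge\ d_k(G)\ \ge\ e_k(G)\ \ge\ d_{\mathrm{dom},k}(G).$$ 3. Let $\mathfrak U\in\mathfrak{Ts}$ be universal and isomorphic to a subalgebra of $D_k$ (for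 example, any basic algebra). Then $$e_k(G)=e_k(Q(\mathfrak U))=\min\{\mathrm{tr.deg}_k\,k(\wp)\mid k(\wp)\in\mathcal S_{\mathfrak U}\},$$ some $k(\wp)\in\mathcal S_{\mathfrak U}$ is an essential $G$-field, and for every essential $G$-field $K$ there are an essential $G$-field $k(\wp)\in\mathcal S_{\mathfrak U}$ and a $G$-equivariant embedding of $k$-algebras $k(\wp)\hookrightarrow K$ over whose image $K$ is algebraic. -/

import Mathlib

universe u v w

namespace TraceSurj

noncomputable section

/-! ### Group actions by `k`-algebra automorphisms

An action of `G` on a commutative `k`-algebra `A` is a homomorphism `G →* (A ≃ₐ[k] A)`; it is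
faithful iff this homomorphism is injective. Left actions are used throughout (a right action is
turned into a left one by `g • a = a g⁻¹`). -/

/-- An action by algebra endomorphisms is an action by algebra automorphisms. -/
def actOfEnd {k G A : Type*} [Field k] [Group G] [CommRing A] [Algebra k A]
    (f : G →* (A →ₐ[k] A)) : G →* (A ≃ₐ[k] A) :=
  (AlgEquiv.algHomUnitsEquiv k A).toMonoidHom.comp f.toHomUnits

@[simp]
theorem actOfEnd_apply {k G A : Type*} [Field k] [Group G] [CommRing A] [Algebra k A]
    (f : G →* (A →ₐ[k] A)) (g : G) (a : A) : actOfEnd f g a = f g a := rfl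

/-- The ideal `I` is `G`-stable. -/
def IsStable {k G A : Type*} [Field k] [Group G] [CommRing A] [Algebra k A]
    (σ : G →* (A ≃ₐ[k] A)) (I : Ideal A) : Prop :=
  ∀ g : G, ∀ a ∈ I, σ g a ∈ I

/-- The induced action on the quotient by a `G`-stable ideal: `g (a + I) = g a + I`. -/
def quotAct {k G A : Type*} [Field k] [Group G] [CommRing A] [Algebra k A]
    (σ : G →* (A ≃ₐ[k] A)) (I : Ideal A) (hI : IsStable σ I) : G →* ((A ⧸ I) ≃ₐ[k] (A ⧸ I)) :=
  actOfEnd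
    { toFun := fun g => Ideal.quotientMapₐ I (σ g : A →ₐ[k] A) (fun a ha => hI g a ha)
      map_one' := by
        refine Ideal.Quotient.algHom_ext k (AlgHom.ext fun a => ?_)
        simp
      map_mul' := fun g h => by
        refine Ideal.Quotient.algHom_ext k (AlgHom.ext fun a => ?_)
        simp only [map_mul]
        rfl }

@[simp]
theorem quotAct_mk {k G A : Type*} [Field k] [Group G] [CommRing A] [Algebra k A]
    (σ : G →* (A ≃ₐ[k] A)) (I : Ideal A) (hI : IsStable σ I) (g : G) (a : A) :
    quotAct σ I hI g (Ideal.Quotient.mk I a) = Ideal.Quotient.mk I (σ g a) := rfl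

/-- The induced action on the total ring of quotients: `g (a / s) = g a / g s`. -/
def fracAct {k G A : Type*} [Field k] [Group G] [CommRing A] [Algebra k A]
    (σ : G →* (A ≃ₐ[k] A)) : G →* (FractionRing A ≃ₐ[k] FractionRing A) where
  toFun g := IsFractionRing.algEquivOfAlgEquiv (σ g)
  map_one' := by
    apply AlgEquiv.coe_toAlgHom_injective
    refine IsLocalization.algHom_ext (nonZeroDivisors A) (AlgHom.ext fun a => ?_)
    change IsFractionRing.algEquivOfAlgEquiv (σ 1) (algebraMap A (FractionRing A) a) =
      algebraMap A (FractionRing A) a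
    simp
  map_mul' g h := by
    apply AlgEquiv.coe_toAlgHom_injective
    refine IsLocalization.algHom_ext (nonZeroDivisors A) (AlgHom.ext fun a => ?_)
    change IsFractionRing.algEquivOfAlgEquiv (σ (g * h)) (algebraMap A (FractionRing A) a) =
      IsFractionRing.algEquivOfAlgEquiv (σ g)
        (IsFractionRing.algEquivOfAlgEquiv (σ h) (algebraMap A (FractionRing A) a) :
          FractionRing A)
    simp

@[simp]
theorem fracAct_algebraMap {k G A : Type*} [Field k] [Group G] [CommRing A] [Algebra k A]
    (σ : G →* (A ≃ₐ[k] A)) (g : G) (a : A) :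
    fracAct σ g (algebraMap A (FractionRing A) a) = algebraMap A (FractionRing A) (σ g a) :=
  IsFractionRing.algEquivOfAlgEquiv_algebraMap (σ g) a

/-- The action on the symmetric algebra `S(W)` induced by a linear representation on `W`. -/
def symAct {k G W : Type*} [Field k] [Group G] [AddCommGroup W] [Module k W]
    (ρ : Representation k G W) : G →* (SymmetricAlgebra k W ≃ₐ[k] SymmetricAlgebra k W) :=
  actOfEnd
    { toFun := fun g => SymmetricAlgebra.lift (SymmetricAlgebra.ι k W ∘ₗ ρ g)
      map_one' := by
        refine SymmetricAlgebra.algHom_ext (LinearMap.ext fun x => ?_)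
        simp
      map_mul' := fun g h => by
        refine SymmetricAlgebra.algHom_ext (LinearMap.ext fun x => ?_)
        simp }

@[simp]
theorem symAct_ι {k G W : Type*} [Field k] [Group G] [AddCommGroup W] [Module k W]
    (ρ : Representation k G W) (g : G) (x : W) :
    symAct ρ g (SymmetricAlgebra.ι k W x) = SymmetricAlgebra.ι k W (ρ g x) := by
  simp [symAct]

/-! ### Essential dimension -/

/-- The transcendence degree, with value `⊤` if it is infinite. -/
def trDeg (k K : Type*) [Field k] [CommRing K] [Algebra k K] : ℕ∞ :=
  Cardinal.toENat (Algebra.trdeg k K)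

/-- `e_k(K)`: the minimal transcendence degree of a `G`-stable field `E` with `k ≤ E ≤ K` on which
`G` acts faithfully. -/
def essDimField {k G K : Type*} [Field k] [Group G] [CommRing K] [Algebra k K]
    (σ : G →* (K ≃ₐ[k] K)) : ℕ∞ :=
  sInf {t | ∃ E : Subalgebra k K, IsField E ∧ (∀ g : G, ∀ x ∈ E, σ g x ∈ E) ∧
    (∀ g : G, (∀ x ∈ E, σ g x = x) → g = 1) ∧ trDeg k E = t}

/-- The essential dimension `e_k(G)`, computed from the representation `V` of `G`: it is
`e_k(k(V*))`, where `k(V*)` is the field of fractions of `S(V*)`. -/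
def essDim {k G V : Type*} [Field k] [Group G] [AddCommGroup V] [Module k V]
    (ρ : Representation k G V) : ℕ∞ :=
  essDimField (fracAct (symAct ρ.dual))

/-- `K`, with the action `σ`, is an essential `G`-field, where `e` is the essential dimension
`e_k(G)`: a field on which `G` acts faithfully such that `tr.deg_k K = e_k(G) = e_k(K)`. -/
structure IsEssential {k G K : Type*} [Field k] [Group G] [CommRing K] [Algebra k K]
    (e : ℕ∞) (σ : G →* (K ≃ₐ[k] K)) : Prop where
  isField : IsField K
  faithful : Function.Injective σ
  trDeg_eq : trDeg k K = e
  essDimField_eq : essDimField σ = e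

/-! ### The category of trace-surjective algebras -/

/-- Finitely generated trace-surjective `k`-`G`-algebras: every invariant is a trace. -/
structure Ts (k G : Type u) [Field k] [Group G] [Fintype G] where
  carrier : Type u
  [commRing : CommRing carrier]
  [algebra : Algebra k carrier]
  act : G →* (carrier ≃ₐ[k] carrier)
  finiteType : Algebra.FiniteType k carrier
  traceSurjective : ∀ a : carrier, (∀ g : G, act g a = a) → ∃ b : carrier, ∑ g : G, act g b = a

attribute [instance] Ts.commRing Ts.algebra

/-- Morphisms: the `G`-equivariant homomorphisms of `k`-algebras. -/
structure Ts.Hom {k G : Type u} [Field k] [Group G] [Fintype G] (A B : Ts k G) where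
  toAlgHom : A.carrier →ₐ[k] B.carrier
  equivariant : ∀ (g : G) (a : A.carrier), toAlgHom (A.act g a) = B.act g (toAlgHom a)

instance Ts.instCategory {k G : Type u} [Field k] [Group G] [Fintype G] :
    CategoryTheory.Category.{u} (Ts k G) where
  Hom A B := Ts.Hom A B
  id A := ⟨AlgHom.id k A.carrier, fun _ _ => rfl⟩
  comp f g := ⟨g.toAlgHom.comp f.toAlgHom, fun h a => by
    simp [f.equivariant, g.equivariant]⟩

/-- Universal objects are the weakly initial ones. -/
def IsUniversal {k G : Type u} [Field k] [Group G] [Fintype G] (A : Ts k G) : Prop :=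
  ∀ B : Ts k G, Nonempty (A ⟶ B)

/-- `A ≺ B`: there is a monomorphism from `A` to `B`. -/
def Prec {k G : Type u} [Field k] [Group G] [Fintype G] (A B : Ts k G) : Prop :=
  ∃ f : A ⟶ B, CategoryTheory.Mono f

/-- `B` is minimal if `A ≺ B` always implies `B ≺ A`. -/
def IsMinimal {k G : Type u} [Field k] [Group G] [Fintype G] (B : Ts k G) : Prop :=
  ∀ A : Ts k G, Prec A B → Prec B A

/-- Basic objects are the minimal universal ones. -/
def IsBasic {k G : Type u} [Field k] [Group G] [Fintype G] (B : Ts k G) : Prop :=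
  IsUniversal B ∧ IsMinimal B

/-! ### The algebra `D_k` -/

/-- The action `g X_h = X_{gh}` on the polynomial ring `k[X_h | h ∈ G]`, that is, on the symmetric
algebra of the regular representation. -/
def regAct (k G : Type*) [Field k] [Group G] :
    G →* (MvPolynomial G k ≃ₐ[k] MvPolynomial G k) :=
  actOfEnd
    { toFun := fun g => MvPolynomial.rename (fun h => g * h)
      map_one' := by
        refine MvPolynomial.algHom_ext fun h => ?_
        simp
      map_mul' := fun g g' => by
        refine MvPolynomial.algHom_ext fun h => ?_
        simp [mul_assoc] }

@[simp]
theorem regAct_X (k G : Type*) [Field k] [Group G] (g h : G) :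
    regAct k G g (MvPolynomial.X h) = MvPolynomial.X (g * h) := by
  simp [regAct]

/-- The ideal generated by `(∑ h, X_h) - 1`. -/
def dIdeal (k G : Type*) [Field k] [Group G] [Fintype G] : Ideal (MvPolynomial G k) :=
  Ideal.span {(∑ h : G, MvPolynomial.X h) - 1}

theorem dIdeal_stable (k G : Type*) [Field k] [Group G] [Fintype G] :
    IsStable (regAct k G) (dIdeal k G) := by
  intro g a ha
  have hinv : regAct k G g ((∑ h : G, MvPolynomial.X h) - 1) = (∑ h : G, MvPolynomial.X h) - 1 := by
    simp only [map_sub, map_sum, map_one, regAct_X]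
    rw [Fintype.sum_equiv (Equiv.mulLeft g) (fun h => (MvPolynomial.X (g * h) : MvPolynomial G k))
      (fun h => MvPolynomial.X h) (fun _ => rfl)]
  obtain ⟨b, rfl⟩ := Ideal.mem_span_singleton'.1 ha
  rw [map_mul, hinv]
  exact Ideal.mul_mem_left _ _ (Ideal.subset_span rfl)

/-- `D_k = k[X_h | h ∈ G] / (∑ h, X_h - 1)`, the dehomogenized symmetric algebra of the regular
representation, as an object of the category. -/
def Ts.D (k G : Type u) [Field k] [Group G] [Fintype G] : Ts k G where
  carrier := MvPolynomial G k ⧸ dIdeal k G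
  act := quotAct (regAct k G) (dIdeal k G) (dIdeal_stable k G)
  finiteType := inferInstance
  traceSurjective := fun a ha => by
    refine ⟨a * Ideal.Quotient.mk _ (MvPolynomial.X 1), ?_⟩
    simp only [map_mul, ha, quotAct_mk, regAct_X, mul_one]
    rw [← Finset.mul_sum, ← map_sum]
    have h1 : Ideal.Quotient.mk (dIdeal k G) (∑ h : G, MvPolynomial.X h) = 1 := by
      rw [← map_one (Ideal.Quotient.mk (dIdeal k G))]
      exact Ideal.Quotient.eq.2 (Ideal.subset_span rfl)
    rw [h1, mul_one]

/-- `A` is isomorphic to a subalgebra of `D_k`: there is an injective morphism `A → D_k`. -/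
def EmbedsInD {k G : Type u} [Field k] [Group G] [Fintype G] (A : Ts k G) : Prop :=
  ∃ f : Ts.Hom A (Ts.D k G), Function.Injective f.toAlgHom

/-- `C` is cyclic if it is a quotient of `D_k` by a `G`-stable ideal. -/
def IsCyclicTs {k G : Type u} [Field k] [Group G] [Fintype G] (C : Ts k G) : Prop :=
  ∃ f : Ts.Hom (Ts.D k G) C, Function.Surjective f.toAlgHom

/-! ### Embedded residue class fields -/

/-- The `G`-stable prime ideals of `A`. -/
structure StablePrime {k G : Type u} [Field k] [Group G] [Fintype G] (A : Ts k G) where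
  ideal : Ideal A.carrier
  isPrime : ideal.IsPrime
  stable : IsStable A.act ideal

/-- The residue class field `k(℘)`, the field of fractions of `A/℘`. -/
abbrev StablePrime.ResField {k G : Type u} [Field k] [Group G] [Fintype G] {A : Ts k G}
    (P : StablePrime A) : Type u :=
  FractionRing (A.carrier ⧸ P.ideal)

/-- The action of `G` on `k(℘)` induced by the action on `A`. -/
def StablePrime.resAct {k G : Type u} [Field k] [Group G] [Fintype G] {A : Ts k G}
    (P : StablePrime A) : G →* (P.ResField ≃ₐ[k] P.ResField) :=
  fracAct (quotAct A.act P.ideal P.stable)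

/-- The set `𝒮_A`, as a set of `G`-stable primes: those `℘` for which there is a `G`-equivariant
embedding of `k(℘)` into the total ring of quotients of `A`. -/
def embeddedPrimes {k G : Type u} [Field k] [Group G] [Fintype G] (A : Ts k G) :
    Set (StablePrime A) :=
  {P | ∃ φ : P.ResField →ₐ[k] FractionRing A.carrier, Function.Injective φ ∧
    ∀ (g : G) (x : P.ResField), φ (P.resAct g x) = fracAct A.act g (φ x)}

end

end TraceSurj

namespace TraceSurj

/-! ### Transcendence degree and Krull dimension -/

/-! The whole argument runs on points, the elements of trace one. A point of an object `A` is the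
same as a morphism `D_k → A`; hence `D_k` is weakly initial, and an object is universal as soon as
it maps to `D_k`. A field with faithful action has a point, by Dedekind independence
(`exists_isPoint`). Conversely, since `G` is a `p`-group in characteristic `p`, a point forces the
action to be faithful (`IsPoint.injective`). So transcendence degrees of stable subfields can be
compared with those of orbit algebras `k[g b | g ∈ G]` of points `b`.

Basic objects are found as universal subalgebras of `D_k` of least transcendence degree: a
surjection of affine domains that does not lower this degree is injective (`isBasic_of_trDeg_le`).
Conversely, a Noetherian argument puts every basic object inside `D_k` (`IsBasic.embedsInD`). The
bound `n` comes from a stable subalgebra of `D_k` with `n` generators and a point, built from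
iterated Artin–Schreier steps along central subgroups of order `p` (`exists_stable_adjoin_range`).

Essential dimensions are compared through `Specializes`: if every point `b` of `L` has a point `c`
of `K` satisfying all relations of the orbit of `b`, the orbit algebra of `c` is a quotient of that
of `b`, whence `e_k(K) ≤ e_k(L)`. Specialization follows from algebraic independence of
automorphisms (`exists_aeval_orbit_ne_zero`): polynomial rings and symmetric algebras have enough
equivariant maps to an infinite `K` to keep a given denominator nonzero. Applied in both directions
it gives `e_k(k(V*)) = e_k(Q(U))`.

Finally, let `b` be an optimal point of `Q(U)` and `c` its specialization in `K`. Universality gives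
maps from `U` to both fields through these points, with nested kernels. If `e_k(K)` is not smaller
than `e_k(Q(U))`, the degree count forces equal kernels, and the common residue field embeds in both
(`exists_mem_embeddedPrimes`). -/

theorem ringKrullDim_eq_of_isIntegral {R S : Type*} [CommRing R] [CommRing S] [Algebra R S]
    [Algebra.IsIntegral R S] (h : Function.Injective (algebraMap R S)) :
    ringKrullDim S = ringKrullDim R := by
  apply le_antisymm
  · exact Order.krullDim_le_of_strictMono (PrimeSpectrum.comap (algebraMap R S))
      fun _ _ h => Ideal.IsIntegral.comap_lt_comap h
  · refine iSup_le fun l => ?_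
    -- Lying over provides a prime above the bottom of the chain; going up lifts the rest.
    obtain ⟨P, hP, hP'⟩ := Ideal.exists_ideal_over_prime_of_isIntegral (S := S) l.head.asIdeal ⊥ (by
      rw [← RingHom.ker_eq_comap_bot, (RingHom.injective_iff_ker_eq_bot _).1 h]
      exact bot_le)
    have : P.LiesOver l.head.asIdeal := ⟨hP'.2.symm⟩
    have := hP'.1
    obtain ⟨L, hL, -⟩ := Ideal.exists_ltSeries_of_hasGoingUp l P
    rw [← hL]
    exact le_sSup ⟨L, rfl⟩

section trDeg

variable {k : Type*} [Field k]

theorem trDeg_le_of_injective {A B : Type*} [CommRing A] [CommRing B] [Algebra k A] [Algebra k B]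
    (f : A →ₐ[k] B) (hf : Function.Injective f) : trDeg k A ≤ trDeg k B := by
  have := Cardinal.toENat.monotone' (lift_trdeg_le_of_injective f hf)
  simpa [trDeg] using this

theorem trDeg_le_of_surjective {A B : Type*} [CommRing A] [CommRing B] [Algebra k A] [Algebra k B]
    (f : A →ₐ[k] B) (hf : Function.Surjective f) : trDeg k B ≤ trDeg k A := by
  have := Cardinal.toENat.monotone' (lift_trdeg_le_of_surjective f hf)
  simpa [trDeg] using this

theorem trDeg_eq_of_algEquiv {A B : Type*} [CommRing A] [CommRing B] [Algebra k A] [Algebra k B]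
    (e : A ≃ₐ[k] B) : trDeg k A = trDeg k B :=
  le_antisymm (trDeg_le_of_injective e.toAlgHom e.injective)
    (trDeg_le_of_injective e.symm.toAlgHom e.symm.injective)

theorem trDeg_eq_of_isAlgebraic {A B : Type*} [CommRing A] [CommRing B] [IsDomain B] [Algebra k A]
    [Algebra k B] [Algebra A B] [IsScalarTower k A B] (h : Function.Injective (algebraMap A B))
    [Algebra.IsAlgebraic A B] : trDeg k B = trDeg k A := by
  have := (faithfulSMul_iff_algebraMap_injective A B).2 h
  have : Nontrivial A := (algebraMap A B).domain_nontrivial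
  have h1 := lift_trdeg_add_eq k A B
  rw [trdeg_eq_zero (R := A) (A := B), Cardinal.lift_zero, add_zero] at h1
  have h2 := congrArg Cardinal.toENat h1
  simpa [trDeg] using h2.symm

theorem trDeg_fractionRing {A K : Type*} [CommRing A] [IsDomain A] [Algebra k A] [Field K]
    [Algebra k K] [Algebra A K] [IsScalarTower k A K] [IsFractionRing A K] :
    trDeg k K = trDeg k A := by
  have : Algebra.IsAlgebraic A K := IsFractionRing.comap_isAlgebraic_iff (K := K).2 inferInstance
  exact trDeg_eq_of_isAlgebraic (IsFractionRing.injective A K)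

theorem trDeg_mvPolynomial_fin (s : ℕ) : trDeg k (MvPolynomial (Fin s) k) = s := by
  simp [trDeg, MvPolynomial.trdeg_of_isDomain]

variable {A B : Type*} [CommRing A] [CommRing B] [Algebra k A] [Algebra k B]

theorem trDeg_ne_top [Algebra.FiniteType k A] : trDeg k A ≠ ⊤ := by
  simpa [trDeg] using trdeg_lt_aleph0_of_finiteType (R := k) (S := A)

/-- Noether normalization: both invariants are unchanged along an integral extension of a polynomial
ring in `s` variables, where both equal `s`. -/
theorem ringKrullDim_eq_trDeg [IsDomain A] [Algebra.FiniteType k A] :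
    ringKrullDim A = (trDeg k A : WithBot ℕ∞) := by
  obtain ⟨s, g, hg, hi⟩ := exists_integral_inj_algHom_of_fg k A
  let := g.toRingHom.toAlgebra
  have : IsScalarTower k (MvPolynomial (Fin s) k) A := .of_algHom g
  have : Algebra.IsIntegral (MvPolynomial (Fin s) k) A := ⟨hi⟩
  rw [ringKrullDim_eq_of_isIntegral (R := MvPolynomial (Fin s) k) hg,
    trDeg_eq_of_isAlgebraic (A := MvPolynomial (Fin s) k) hg, trDeg_mvPolynomial_fin]
  simp

/-- Killing a nonzero element of a domain lowers the Krull dimension by at least one. -/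
theorem injective_of_surjective_of_trDeg_le [IsDomain A] [IsDomain B] [Algebra.FiniteType k A]
    (f : A →ₐ[k] B) (hf : Function.Surjective f) (h : trDeg k A ≤ trDeg k B) :
    Function.Injective f := by
  have : Algebra.FiniteType k B := .of_surjective f hf
  rw [injective_iff_map_eq_zero]
  intro a ha
  by_contra h0
  have h1 := ringKrullDim_succ_le_of_surjective f.toRingHom hf (mem_nonZeroDivisors_of_ne_zero h0) ha
  rw [ringKrullDim_eq_trDeg (k := k), ringKrullDim_eq_trDeg (k := k)] at h1
  have h2 : trDeg k B + 1 ≤ trDeg k A := by exact_mod_cast h1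
  have h3 := (ENat.add_one_le_iff (trDeg_ne_top (k := k) (A := B))).1 h2
  exact absurd h3 (not_lt.2 h)

theorem isAlgebraic_range_of_trDeg_eq [IsDomain B] (f : A →ₐ[k] B)
    (hf : Function.Injective f) (h : trDeg k A = trDeg k B) (ht : trDeg k B ≠ ⊤) :
    Algebra.IsAlgebraic f.range B := by
  have h1 : trDeg k f.range = trDeg k B := by
    rw [← h, trDeg_eq_of_algEquiv (AlgEquiv.ofInjective f hf)]
  have h2 := congrArg Cardinal.toENat (trdeg_add_eq k f.range (A := B))
  rw [map_add] at h2
  change trDeg k f.range + _ = trDeg k B at h2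
  rw [h1] at h2
  have h3 : Cardinal.toENat (Algebra.trdeg f.range B) = 0 := by
    have : trDeg k B + Cardinal.toENat (Algebra.trdeg f.range B) = trDeg k B + 0 := by simpa using h2
    exact ENat.add_right_injective_of_ne_top ht this
  exact trdeg_eq_zero_iff.1 (by simpa using h3)

end trDeg

end TraceSurj

namespace TraceSurj

noncomputable section

/-! ### Equivariant homomorphisms and points of trace one -/

section Actions

variable {k G A B C : Type*} [Field k] [Group G] [CommRing A] [Algebra k A] [CommRing B]
  [Algebra k B] [CommRing C] [Algebra k C]

/-- `f` is `G`-equivariant. -/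
def IsEquivariant (σ : G →* (A ≃ₐ[k] A)) (τ : G →* (B ≃ₐ[k] B)) (f : A →ₐ[k] B) : Prop :=
  ∀ (g : G) (a : A), f (σ g a) = τ g (f a)

theorem IsEquivariant.comp {σ : G →* (A ≃ₐ[k] A)} {τ : G →* (B ≃ₐ[k] B)} {υ : G →* (C ≃ₐ[k] C)}
    {f : A →ₐ[k] B} {f' : B →ₐ[k] C} (hf' : IsEquivariant τ υ f') (hf : IsEquivariant σ τ f) :
    IsEquivariant σ υ (f'.comp f) := fun g a => by
  simp [hf g a, hf' g (f a)]

/-- The restriction of an action to a stable subalgebra. -/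
def subAct (σ : G →* (A ≃ₐ[k] A)) (S : Subalgebra k A) (hS : ∀ g : G, ∀ x ∈ S, σ g x ∈ S) :
    G →* (S ≃ₐ[k] S) :=
  actOfEnd
    { toFun := fun g => ((σ g : A →ₐ[k] A).comp S.val).codRestrict S fun x => hS g x x.2
      map_one' := by ext; simp
      map_mul' := fun g h => by
        ext x
        change σ (g * h) x = σ g (σ h x)
        simp }

theorem isEquivariant_val (σ : G →* (A ≃ₐ[k] A)) (S : Subalgebra k A)
    (hS : ∀ g : G, ∀ x ∈ S, σ g x ∈ S) : IsEquivariant (subAct σ S hS) σ S.val :=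
  fun _ _ => rfl

theorem IsEquivariant.range_stable {σ : G →* (A ≃ₐ[k] A)} {τ : G →* (B ≃ₐ[k] B)} {f : A →ₐ[k] B}
    (hf : IsEquivariant σ τ f) (g : G) (x : B) (hx : x ∈ f.range) : τ g x ∈ f.range := by
  obtain ⟨a, rfl⟩ := hx
  exact ⟨σ g a, hf g a⟩

theorem IsEquivariant.ker_stable {σ : G →* (A ≃ₐ[k] A)} {τ : G →* (B ≃ₐ[k] B)} {f : A →ₐ[k] B}
    (hf : IsEquivariant σ τ f) : IsStable σ (RingHom.ker f) := by
  intro g a ha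
  rw [RingHom.mem_ker] at ha ⊢
  rw [hf, ha, map_zero]

theorem isEquivariant_quotient_mk (σ : G →* (A ≃ₐ[k] A)) (I : Ideal A) (hI : IsStable σ I) :
    IsEquivariant σ (quotAct σ I hI) (Ideal.Quotient.mkₐ k I) := fun _ _ => rfl

theorem isEquivariant_kerLift {σ : G →* (A ≃ₐ[k] A)} {τ : G →* (B ≃ₐ[k] B)} {f : A →ₐ[k] B}
    (hf : IsEquivariant σ τ f) :
    IsEquivariant (quotAct σ _ hf.ker_stable) τ (Ideal.kerLiftAlg f) := by
  intro g a
  obtain ⟨a, rfl⟩ := Ideal.Quotient.mk_surjective a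
  rw [quotAct_mk, Ideal.kerLiftAlg_mk, Ideal.kerLiftAlg_mk, hf]

theorem fracAct_injective {σ : G →* (A ≃ₐ[k] A)} (h : Function.Injective σ) :
    Function.Injective (fracAct σ) := fun g g' hgg => h <| AlgEquiv.ext fun a =>
  IsFractionRing.injective A (FractionRing A) <| by
    rw [← fracAct_algebraMap, ← fracAct_algebraMap, hgg]

/-- The extension of an injective homomorphism from a domain to a field to the field of
fractions. -/
def fracLift {K : Type*} [Field K] [Algebra k K] (f : A →ₐ[k] K) (hf : Function.Injective f) :
    FractionRing A →ₐ[k] K :=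
  IsLocalization.liftAlgHom (M := nonZeroDivisors A) (f := f) fun y => by
    have := f.toRingHom.domain_nontrivial
    exact (map_ne_zero_of_mem_nonZeroDivisors f.toRingHom hf y.2).isUnit

@[simp]
theorem fracLift_algebraMap {K : Type*} [Field K] [Algebra k K] (f : A →ₐ[k] K)
    (hf : Function.Injective f) (a : A) :
    fracLift f hf (algebraMap A (FractionRing A) a) = f a := by
  simp [fracLift]

theorem IsEquivariant.fracLift {K : Type*} [Field K] [Algebra k K] {σ : G →* (A ≃ₐ[k] A)}
    {τ : G →* (K ≃ₐ[k] K)} {f : A →ₐ[k] K} (he : IsEquivariant σ τ f)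
    (hf : Function.Injective f) : IsEquivariant (fracAct σ) τ (fracLift f hf) := by
  intro g x
  have : (TraceSurj.fracLift f hf).comp (fracAct σ g : FractionRing A →ₐ[k] FractionRing A) =
      ((τ g : K →ₐ[k] K)).comp (TraceSurj.fracLift f hf) := by
    refine IsLocalization.algHom_ext (nonZeroDivisors A) (AlgHom.ext fun a => ?_)
    change TraceSurj.fracLift f hf (fracAct σ g (algebraMap A (FractionRing A) a)) =
      τ g (TraceSurj.fracLift f hf (algebraMap A (FractionRing A) a))
    rw [fracAct_algebraMap, fracLift_algebraMap, fracLift_algebraMap, he]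
  exact DFunLike.congr_fun this x

variable [Fintype G]

/-- `b` has trace one. -/
def IsPoint (σ : G →* (A ≃ₐ[k] A)) (b : A) : Prop := ∑ g : G, σ g b = 1

theorem IsPoint.map {σ : G →* (A ≃ₐ[k] A)} {τ : G →* (B ≃ₐ[k] B)} {f : A →ₐ[k] B}
    (hf : IsEquivariant σ τ f) {b : A} (hb : IsPoint σ b) : IsPoint τ (f b) := by
  unfold IsPoint at hb ⊢
  simp only [← hf _ b, ← map_sum, hb, map_one]

theorem IsPoint.of_map {σ : G →* (A ≃ₐ[k] A)} {τ : G →* (B ≃ₐ[k] B)} {f : A →ₐ[k] B}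
    (hf : IsEquivariant σ τ f) (hi : Function.Injective f) {b : A} (hb : IsPoint τ (f b)) :
    IsPoint σ b := by
  unfold IsPoint at hb ⊢
  apply hi
  simp only [map_sum, map_one, hf _ b, hb]

theorem sum_eq_sum_quotient (N : Subgroup G) [Fintype (G ⧸ N)] [Fintype N] {M : Type*}
    [AddCommMonoid M] (f : G → M) : ∑ g : G, f g = ∑ q : G ⧸ N, ∑ z : N, f (q.out * z) := by
  rw [← Fintype.sum_prod_type']
  refine (Function.Bijective.sum_comp (e := fun x : (G ⧸ N) × N => x.1.out * (x.2 : G))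
    ⟨?_, fun g => ?_⟩ f).symm
  · rintro ⟨q, z⟩ ⟨q', z'⟩ h
    have hq : q = q' := by
      have := congrArg (QuotientGroup.mk : G → G ⧸ N) h
      simpa using this
    subst hq
    simpa using h
  · refine ⟨⟨g, (g : G ⧸ N).out⁻¹ * g, ?_⟩, by simp⟩
    rw [← QuotientGroup.eq, QuotientGroup.out_eq']

/-- Distinct automorphisms are linearly independent, so some trace is nonzero; being invariant, it
can be divided out. -/
theorem exists_isPoint (σ : G →* (A ≃ₐ[k] A)) (hA : IsField A) (hσ : Function.Injective σ) :
    ∃ b, IsPoint σ b := by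
  have := hA.isDomain
  have hli := (linearIndependent_monoidHom A A).comp
    (fun g : G => ((σ g : A →ₐ[k] A) : A →* A)) (fun g g' h => hσ <| AlgEquiv.ext fun a =>
      DFunLike.congr_fun h a)
  rw [Fintype.linearIndependent_iff] at hli
  have : ∃ x : A, ∑ g : G, σ g x ≠ 0 := by
    by_contra! h
    refine one_ne_zero (hli (fun _ => 1) (funext fun x => ?_) 1)
    simpa using h x
  obtain ⟨x, hx⟩ := this
  obtain ⟨y, hy⟩ := hA.mul_inv_cancel hx
  have hinv : ∀ g, σ g (∑ h : G, σ h x) = ∑ h : G, σ h x := fun g => by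
    rw [map_sum, ← Fintype.sum_equiv (Equiv.mulLeft g) (fun h => σ g (σ h x)) (fun h => σ h x)]
    intro h
    simp
  have hy' : ∀ g, σ g y = y := fun g => by
    apply mul_left_cancel₀ hx
    rw [hy, ← map_one (σ g), ← hy, map_mul, hinv]
  refine ⟨x * y, ?_⟩
  simp [IsPoint, hy', ← Finset.sum_mul, hy]

/-- Summing over cosets of the kernel makes every trace a multiple of the kernel's order. If the
kernel is nontrivial, `p` divides that order and all traces vanish. -/
theorem IsPoint.injective {p n : ℕ} [Fact p.Prime] [CharP k p] (hG : Nat.card G = p ^ n)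
    [Nontrivial A] {σ : G →* (A ≃ₐ[k] A)} {b : A} (hb : IsPoint σ b) : Function.Injective σ := by
  classical
  rw [← MonoidHom.ker_eq_bot_iff]
  by_contra hN
  have : CharP A p := charP_of_injective_algebraMap (algebraMap k A).injective p
  have hdvd : p ∣ Nat.card σ.ker :=
    (IsPGroup.of_card hG).to_subgroup _ |>.card_eq_or_dvd.resolve_left fun h =>
      hN (Subgroup.card_eq_one.1 h)
  unfold IsPoint at hb
  rw [sum_eq_sum_quotient σ.ker] at hb
  simp only [map_mul, MonoidHom.mem_ker.1 (Subtype.prop _), mul_one, Finset.sum_const,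
    Finset.card_univ, ← Nat.card_eq_fintype_card, nsmul_eq_mul,
    (CharP.cast_eq_zero_iff A p _).2 hdvd, zero_mul] at hb
  simp at hb

end Actions

/-! ### Orbit homomorphisms -/

section Orbit

variable {k G A B : Type*} [Field k] [Group G] [CommRing A] [Algebra k A] [CommRing B]
  [Algebra k B]

/-- The homomorphism `k[X_g | g ∈ G] → A` with `X_g ↦ g b`. -/
def orbitHom (σ : G →* (A ≃ₐ[k] A)) (b : A) : MvPolynomial G k →ₐ[k] A :=
  MvPolynomial.aeval fun g => σ g b

@[simp]
theorem orbitHom_X (σ : G →* (A ≃ₐ[k] A)) (b : A) (g : G) :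
    orbitHom σ b (MvPolynomial.X g) = σ g b := by
  simp [orbitHom]

theorem isEquivariant_orbitHom (σ : G →* (A ≃ₐ[k] A)) (b : A) :
    IsEquivariant (regAct k G) σ (orbitHom σ b) := by
  intro g P
  have : (orbitHom σ b).comp (regAct k G g : MvPolynomial G k →ₐ[k] MvPolynomial G k) =
      ((σ g : A →ₐ[k] A)).comp (orbitHom σ b) :=
    MvPolynomial.algHom_ext fun h => by simp
  exact DFunLike.congr_fun this P

theorem comp_orbitHom {σ : G →* (A ≃ₐ[k] A)} {τ : G →* (B ≃ₐ[k] B)} {f : A →ₐ[k] B}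
    (hf : IsEquivariant σ τ f) (b : A) : f.comp (orbitHom σ b) = orbitHom τ (f b) :=
  MvPolynomial.algHom_ext fun h => by simp [hf h b]

theorem adjoin_stable (σ : G →* (A ≃ₐ[k] A)) {s : Set A}
    (hs : ∀ g : G, ∀ x ∈ s, σ g x ∈ Algebra.adjoin k s) (g : G) (x : A)
    (hx : x ∈ Algebra.adjoin k s) : σ g x ∈ Algebra.adjoin k s := by
  have : Algebra.adjoin k s ≤ (Algebra.adjoin k s).comap (σ g : A →ₐ[k] A) :=
    Algebra.adjoin_le fun y hy => hs g y hy
  exact this hx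

/-- The diagonal action on a product. -/
def prodAct (σ : G →* (A ≃ₐ[k] A)) (τ : G →* (B ≃ₐ[k] B)) : G →* ((A × B) ≃ₐ[k] (A × B)) :=
  actOfEnd
    { toFun := fun g => ((σ g : A →ₐ[k] A).comp (AlgHom.fst k A B)).prod
        ((τ g : B →ₐ[k] B).comp (AlgHom.snd k A B))
      map_one' := by ext <;> simp
      map_mul' := fun g h => by
        refine AlgHom.ext fun x => ?_
        change (σ (g * h) x.1, τ (g * h) x.2) = (σ g (σ h x.1), τ g (τ h x.2))
        simp }

@[simp]
theorem prodAct_apply (σ : G →* (A ≃ₐ[k] A)) (τ : G →* (B ≃ₐ[k] B)) (g : G) (x : A × B) :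
    prodAct σ τ g x = (σ g x.1, τ g x.2) := rfl

variable [Fintype G]

theorem orbitHom_dIdeal {σ : G →* (A ≃ₐ[k] A)} {b : A} (hb : IsPoint σ b)
    (P : MvPolynomial G k) (hP : P ∈ dIdeal k G) : orbitHom σ b P = 0 := by
  obtain ⟨Q, rfl⟩ := Ideal.mem_span_singleton'.1 hP
  rw [map_mul, map_sub, map_sum, map_one]
  simp only [orbitHom_X]
  rw [show ∑ g : G, σ g b = 1 from hb, sub_self, mul_zero]

/-- The homomorphism `D_k → A` with `X_g ↦ g b`, for a point `b`. -/
def pointHom {σ : G →* (A ≃ₐ[k] A)} {b : A} (hb : IsPoint σ b) :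
    MvPolynomial G k ⧸ dIdeal k G →ₐ[k] A :=
  Ideal.Quotient.liftₐ _ (orbitHom σ b) (orbitHom_dIdeal hb)

@[simp]
theorem pointHom_mk {σ : G →* (A ≃ₐ[k] A)} {b : A} (hb : IsPoint σ b) (P : MvPolynomial G k) :
    pointHom hb (Ideal.Quotient.mk (dIdeal k G) P) = orbitHom σ b P := rfl

theorem isEquivariant_pointHom {σ : G →* (A ≃ₐ[k] A)} {b : A} (hb : IsPoint σ b) :
    IsEquivariant (quotAct (regAct k G) (dIdeal k G) (dIdeal_stable k G)) σ (pointHom hb) := by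
  intro g a
  obtain ⟨P, rfl⟩ := Ideal.Quotient.mk_surjective a
  rw [quotAct_mk, pointHom_mk, pointHom_mk, isEquivariant_orbitHom]

/-- For every point of `A` there is a point of `B` whose orbit satisfies all the algebraic
relations over `k` which hold for the orbit of the given point. -/
def Specializes (σ : G →* (A ≃ₐ[k] A)) (τ : G →* (B ≃ₐ[k] B)) : Prop :=
  ∀ b, IsPoint σ b → ∃ c, IsPoint τ c ∧ RingHom.ker (orbitHom σ b) ≤ RingHom.ker (orbitHom τ c)

theorem Specializes.of_isEquivariant {C : Type*} [CommRing C] [Algebra k C]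
    {σ : G →* (A ≃ₐ[k] A)} {τ : G →* (B ≃ₐ[k] B)} {υ : G →* (C ≃ₐ[k] C)} {f : A →ₐ[k] B}
    (hf : IsEquivariant σ τ f) (h : Specializes τ υ) :
    Specializes σ υ := by
  intro b hb
  obtain ⟨c, hc, hle⟩ := h (f b) (hb.map hf)
  refine ⟨c, hc, le_trans (fun P hP => ?_) hle⟩
  rw [RingHom.mem_ker] at hP ⊢
  rw [← comp_orbitHom hf, AlgHom.comp_apply, hP, map_zero]

end Orbit

/-! ### Constructions in the category -/

section Ts

variable {k G : Type u} [Field k] [Group G] [Fintype G]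

theorem Ts.exists_isPoint (A : Ts k G) : ∃ b, IsPoint A.act b :=
  A.traceSurjective 1 fun g => map_one (A.act g)

theorem Ts.Hom.isEquivariant {A B : Ts k G} (f : Ts.Hom A B) :
    IsEquivariant A.act B.act f.toAlgHom := f.equivariant

/-- A finitely generated algebra with a point, as an object of the category. -/
def Ts.ofPoint {A : Type u} [CommRing A] [Algebra k A] (σ : G →* (A ≃ₐ[k] A))
    (hA : Algebra.FiniteType k A) (h : ∃ b, IsPoint σ b) : Ts k G where
  carrier := A
  act := σ
  finiteType := hA
  traceSurjective a ha := by
    obtain ⟨b, hb⟩ := h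
    -- The trace is linear over the invariants, so one point suffices.
    refine ⟨a * b, ?_⟩
    simp only [map_mul, ha, ← Finset.mul_sum]
    rw [show ∑ g : G, σ g b = 1 from hb, mul_one]

/-- The quotient by a stable ideal. -/
def Ts.quot (A : Ts k G) (I : Ideal A.carrier) (hI : IsStable A.act I) : Ts k G :=
  have := A.finiteType
  Ts.ofPoint (quotAct A.act I hI) inferInstance
    (A.exists_isPoint.imp' _ fun _ hb => hb.map (isEquivariant_quotient_mk A.act I hI))

/-- The morphism `D_k → A` given by a point of `A`. -/
def Ts.homOfPoint (A : Ts k G) {b : A.carrier} (hb : IsPoint A.act b) : Ts.Hom (Ts.D k G) A :=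
  ⟨pointHom hb, isEquivariant_pointHom hb⟩

theorem Ts.nonempty_hom_of_D (A : Ts k G) : Nonempty (Ts.Hom (Ts.D k G) A) :=
  ⟨A.homOfPoint A.exists_isPoint.choose_spec⟩

/-- The composition of morphisms. -/
def Ts.Hom.comp {A B C : Ts k G} (f : Ts.Hom B C) (f' : Ts.Hom A B) : Ts.Hom A C :=
  ⟨f.toAlgHom.comp f'.toAlgHom, f.isEquivariant.comp f'.isEquivariant⟩

theorem Ts.Hom.ext_toAlgHom {A B : Ts k G} {f f' : Ts.Hom A B} (h : f.toAlgHom = f'.toAlgHom) :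
    f = f' := by
  cases f
  cases f'
  congr 1

theorem isUniversal_iff {A : Ts k G} : IsUniversal A ↔ Nonempty (Ts.Hom A (Ts.D k G)) :=
  ⟨fun h => h _, fun ⟨f⟩ B => B.nonempty_hom_of_D.map fun f' => f'.comp f⟩

/-- The test object must be finitely generated and have a point. Instead of the full kernel pair,
take the subalgebra of `A × A` generated by the orbits of `(b, b)`, with `b` a point, and of `(x,
y)`; its two projections agree after `f`. -/
theorem Ts.Hom.injective_of_mono {A B : Ts k G} (f : A ⟶ B) [CategoryTheory.Mono f] :
    Function.Injective (Ts.Hom.toAlgHom f) := by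
  intro x y hxy
  obtain ⟨b, hb⟩ := A.exists_isPoint
  let σ := prodAct A.act A.act
  let s : Set (A.carrier × A.carrier) :=
    Set.range (fun g => σ g (b, b)) ∪ Set.range (fun g => σ g (x, y))
  have hs : ∀ g : G, ∀ z ∈ s, σ g z ∈ Algebra.adjoin k s := by
    rintro g _ (⟨h, rfl⟩ | ⟨h, rfl⟩)
    · exact Algebra.subset_adjoin (Or.inl ⟨g * h, by simp [σ]⟩)
    · exact Algebra.subset_adjoin (Or.inr ⟨g * h, by simp [σ]⟩)
  have hbs : (b, b) ∈ Algebra.adjoin k s := Algebra.subset_adjoin (Or.inl ⟨1, by simp [σ]⟩)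
  have hxs : (x, y) ∈ Algebra.adjoin k s := Algebra.subset_adjoin (Or.inr ⟨1, by simp [σ]⟩)
  have hfg : Algebra.FiniteType k (Algebra.adjoin k s) :=
    (Algebra.adjoin k s).fg_iff_finiteType.1
      (Subalgebra.fg_def.2 ⟨s, (Set.finite_range _).union (Set.finite_range _), rfl⟩)
  let T : Ts k G := Ts.ofPoint (subAct σ _ (adjoin_stable σ hs)) hfg ⟨⟨_, hbs⟩,
    IsPoint.of_map (isEquivariant_val σ _ (adjoin_stable σ hs)) Subtype.val_injective (by
      change ∑ g : G, (A.act g b, A.act g b) = 1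
      exact Prod.ext (by rw [Prod.fst_sum]; exact hb) (by rw [Prod.snd_sum]; exact hb))⟩
  let p₁ : T ⟶ A := ⟨(AlgHom.fst k _ _).comp (Algebra.adjoin k s).val, fun _ _ => rfl⟩
  let p₂ : T ⟶ A := ⟨(AlgHom.snd k _ _).comp (Algebra.adjoin k s).val, fun _ _ => rfl⟩
  have h : CategoryTheory.CategoryStruct.comp p₁ f = CategoryTheory.CategoryStruct.comp p₂ f := by
    have hle := AlgHom.adjoin_le_equalizer (s := s)
      ((Ts.Hom.toAlgHom f).comp (AlgHom.fst k _ _)) ((Ts.Hom.toAlgHom f).comp (AlgHom.snd k _ _)) (by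
        rintro _ (⟨g, rfl⟩ | ⟨g, rfl⟩)
        · rfl
        · change f.toAlgHom (A.act g x) = f.toAlgHom (A.act g y)
          rw [f.equivariant, f.equivariant, hxy])
    exact Ts.Hom.ext_toAlgHom (AlgHom.ext fun z => hle z.2)
  have h' := (CategoryTheory.cancel_mono f).1 h
  exact DFunLike.congr_fun (congrArg Ts.Hom.toAlgHom h') (⟨_, hxs⟩ : Algebra.adjoin k s)

theorem prec_iff {A B : Ts k G} :
    Prec A B ↔ ∃ f : Ts.Hom A B, Function.Injective f.toAlgHom := by
  refine ⟨fun ⟨f, hf⟩ => ⟨f, Ts.Hom.injective_of_mono f⟩, fun ⟨f, hf⟩ => ⟨f, ⟨fun g h hgh => ?_⟩⟩⟩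
  have h1 : ∀ x, f.toAlgHom (Ts.Hom.toAlgHom g x) = f.toAlgHom (Ts.Hom.toAlgHom h x) := fun x =>
    DFunLike.congr_fun (congrArg Ts.Hom.toAlgHom hgh) x
  exact Ts.Hom.ext_toAlgHom (AlgHom.ext fun x => hf (h1 x))

end Ts

/-! ### Algebraic independence of automorphisms -/

section Artin

variable {k G K : Type*} [Field k] [Group G] [Field K] [Algebra k K]

theorem infinite_fixedPoints [Finite G] [Infinite K] (σ : G →* (K ≃ₐ[k] K)) :
    {x : K | ∀ g, σ g x = x}.Infinite := by
  let := MulSemiringAction.compHom K σ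
  intro hfin
  have : Finite (FixedPoints.subfield G K) := hfin
  have : Finite K := Module.finite_of_finite (FixedPoints.subfield G K)
  exact not_finite K

/-- By Dedekind independence the vectors `(σ g x)_g`, for varying `x`, span `K^G`; each unit vector
is a finite combination of them. -/
theorem exists_finset_dual_family [Fintype G] [DecidableEq G] {σ : G →* (K ≃ₐ[k] K)}
    (hσ : Function.Injective σ) :
    ∃ (J : Finset K) (N : K → G → K),
      ∀ g h, ∑ j : J, σ g j * N j h = if g = h then 1 else 0 := by
  classical
  have hli : LinearIndependent K (fun (g : G) (x : K) => σ g x) :=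
    (linearIndependent_monoidHom K K).comp
      (fun g : G => ((σ g : K →ₐ[k] K) : K →* K)) (fun g g' h => hσ <| AlgEquiv.ext fun a =>
        DFunLike.congr_fun h a)
  have hspan := span_flip_eq_top_iff_linearIndependent.2 hli
  have hmem : ∀ h : G, ∃ c : K →₀ K, (c.sum fun x a => a • fun g => σ g x) =
      fun g => if g = h then 1 else 0 := fun h =>
    Finsupp.mem_span_range_iff_exists_finsupp.1 (by
      have : (fun g => if g = h then (1 : K) else 0) ∈ (⊤ : Submodule K (G → K)) := trivial
      rwa [← hspan] at this)
  choose c hc using hmem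
  refine ⟨Finset.univ.biUnion fun h => (c h).support, fun x h => c h x, fun g h => ?_⟩
  have h1 := congrFun (hc h) g
  rw [Finsupp.sum_of_support_subset (c h) (Finset.subset_biUnion_of_mem (fun h => (c h).support)
    (Finset.mem_univ h)) _ (by simp), Finset.sum_apply] at h1
  rw [Finset.sum_coe_sort _ (fun j => σ g j * c h j), ← h1]
  exact Finset.sum_congr rfl fun x _ => by simp [mul_comm]

/-- The substitution `X_{g,i} = ∑ j, σ_g(j) T_{j,i}` has a left inverse over `K`, so it keeps `P`
nonzero. Since the fixed field is infinite, the `T_{j,i}` can be given invariant values `t_{j,i}`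
without killing it, and then `∑ j, σ_g(j) t_{j,i} = σ_g(∑ j, j t_{j,i})` is a conjugate of one
element. -/
theorem exists_aeval_orbit_ne_zero [Finite G] [Infinite K] {I : Type*} [Finite I]
    {σ : G →* (K ≃ₐ[k] K)} (hσ : Function.Injective σ) {P : MvPolynomial (G × I) k} (hP : P ≠ 0) :
    ∃ c : I → K, MvPolynomial.aeval (fun x : G × I => σ x.1 (c x.2)) P ≠ 0 := by
  classical
  have := Fintype.ofFinite G
  obtain ⟨J, N, hN⟩ := exists_finset_dual_family hσ
  let f : MvPolynomial (G × I) k →ₐ[k] MvPolynomial (J × I) K :=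
    MvPolynomial.aeval fun x => ∑ j : J, MvPolynomial.C (σ x.1 j) * MvPolynomial.X (j, x.2)
  let f' : MvPolynomial (J × I) K →ₐ[K] MvPolynomial (G × I) K :=
    MvPolynomial.aeval fun x => ∑ h : G, MvPolynomial.C (N x.1 h) * MvPolynomial.X (h, x.2)
  have hff' : (f'.restrictScalars k).comp f =
      MvPolynomial.mapAlgHom (Algebra.ofId k K) := by
    refine MvPolynomial.algHom_ext fun x => ?_
    simp only [f, f', AlgHom.comp_apply, MvPolynomial.aeval_X, map_sum, map_mul,
      AlgHom.restrictScalars_apply, MvPolynomial.mapAlgHom_apply, MvPolynomial.map_X]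
    simp only [MvPolynomial.algHom_C, MvPolynomial.algebraMap_eq, Finset.mul_sum]
    rw [Finset.sum_comm]
    simp only [← mul_assoc, ← map_mul, ← Finset.sum_mul, ← map_sum, hN]
    simp
  have hQ : f P ≠ 0 := by
    intro h0
    have := DFunLike.congr_fun hff' P
    rw [AlgHom.comp_apply, h0, map_zero] at this
    exact hP (MvPolynomial.map_injective _ (algebraMap k K).injective (by
      rw [map_zero]; exact this.symm))
  have : ∃ t : J × I → K, (∀ x g, σ g (t x) = t x) ∧ MvPolynomial.eval t (f P) ≠ 0 := by
    by_contra! h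
    exact hQ (MvPolynomial.funext_set (fun _ => {x : K | ∀ g, σ g x = x})
      (fun _ => infinite_fixedPoints σ) fun t ht => by
        rw [map_zero]
        exact h t fun x => ht x trivial)
  obtain ⟨t, ht, hne⟩ := this
  refine ⟨fun i => ∑ j : J, j * t (j, i), ?_⟩
  have : ((MvPolynomial.aeval t : MvPolynomial (J × I) K →ₐ[K] K).restrictScalars k).comp f =
      MvPolynomial.aeval (fun x : G × I => σ x.1 (∑ j : J, j * t (j, x.2))) := by
    refine MvPolynomial.algHom_ext fun x => ?_
    simp [f, ht]
  rw [← this]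
  exact hne

end Artin

/-! ### Specialization of fields of fractions -/

section Dense

variable {k G R K : Type*} [Field k] [Group G] [CommRing R] [IsDomain R] [Algebra k R]
  [Field K] [Algebra k K]

/-- Every nonzero element of `R` survives under an equivariant homomorphism to `K`. -/
def IsDense (σ : G →* (R ≃ₐ[k] R)) (τ : G →* (K ≃ₐ[k] K)) : Prop :=
  ∀ s : R, s ≠ 0 → ∃ φ : R →ₐ[k] K, IsEquivariant σ τ φ ∧ φ s ≠ 0

/-- Localize `R` at the elements that become units in `B`. This ring contains all conjugates of `r /
s`, embeds into the fraction field, so sees the same relations, and maps to `B` by extending `φ`. -/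
theorem ker_orbitHom_div_le {B : Type*} [CommRing B] [Nontrivial B] [Algebra k B]
    {σ : G →* (R ≃ₐ[k] R)} {τ : G →* (B ≃ₐ[k] B)} {φ : R →ₐ[k] B} (hφ : IsEquivariant σ τ φ)
    {r s : R} {c : B} (hs : IsUnit (φ s)) (hc : c * φ s = φ r) :
    RingHom.ker (orbitHom (fracAct σ)
      (algebraMap R (FractionRing R) r / algebraMap R (FractionRing R) s)) ≤
      RingHom.ker (orbitHom τ c) := by
  intro P hP
  let M : Submonoid R := (IsUnit.submonoid B).comap φ
  have hM : M ≤ nonZeroDivisors R := fun x hx => mem_nonZeroDivisors_of_ne_zero fun h0 =>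
    IsUnit.ne_zero (M₀ := B) hx (by rw [h0, map_zero])
  have hsM : ∀ g, σ g s ∈ M := fun g => by
    change IsUnit (φ (σ g s))
    rw [hφ]
    exact hs.map (τ g)
  let ψ : Localization M →ₐ[k] B := IsLocalization.liftAlgHom (M := M) (f := φ) fun y => y.2
  let ι : Localization M →ₐ[k] FractionRing R :=
    IsLocalization.liftAlgHom (M := M) (f := Algebra.algHom k R (FractionRing R)) fun y =>
      IsLocalization.map_units (FractionRing R) (⟨y, hM y.2⟩ : nonZeroDivisors R)
  have hψ : ∀ x, ψ (algebraMap R _ x) = φ x := fun x => IsLocalization.lift_eq _ x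
  have hι' : ∀ x, ι (algebraMap R _ x) = algebraMap R (FractionRing R) x := fun x =>
    IsLocalization.lift_eq _ x
  let y : G → Localization M := fun g => IsLocalization.mk' _ (σ g r) ⟨σ g s, hsM g⟩
  have hι : Function.Injective ι := by
    refine (IsLocalization.lift_injective_iff (M := M) _).2 fun x x' => ?_
    rw [(IsLocalization.injective (Localization M) hM).eq_iff]
    exact (IsFractionRing.injective R (FractionRing R)).eq_iff.symm
  have h1 : ι.comp (MvPolynomial.aeval y) =
      orbitHom (fracAct σ) (algebraMap R (FractionRing R) r / algebraMap R (FractionRing R) s) := by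
    refine MvPolynomial.algHom_ext fun g => ?_
    rw [AlgHom.comp_apply, MvPolynomial.aeval_X, orbitHom_X, map_div₀, fracAct_algebraMap,
      fracAct_algebraMap]
    rw [eq_div_iff (IsFractionRing.to_map_ne_zero_of_mem_nonZeroDivisors (hM (hsM g))), ← hι',
      ← hι', ← map_mul, IsLocalization.mk'_spec]
  have h2 : ψ.comp (MvPolynomial.aeval y) = orbitHom τ c := by
    refine MvPolynomial.algHom_ext fun g => (hs.map (τ g)).mul_right_cancel ?_
    rw [AlgHom.comp_apply, MvPolynomial.aeval_X, orbitHom_X, ← map_mul, hc, ← hφ, ← hφ, ← hψ,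
      ← hψ, ← map_mul, IsLocalization.mk'_spec]
  rw [RingHom.mem_ker, ← h1, AlgHom.comp_apply, map_eq_zero_iff _ hι] at hP
  rw [RingHom.mem_ker, ← h2, AlgHom.comp_apply, hP, map_zero]

theorem IsDense.specializes [Fintype G] {σ : G →* (R ≃ₐ[k] R)} {τ : G →* (K ≃ₐ[k] K)}
    (h : IsDense σ τ) : Specializes (fracAct σ) τ := by
  intro b hb
  obtain ⟨r, s, hs, rfl⟩ := IsFractionRing.div_surjective (A := R) b
  obtain ⟨φ, hφ, hne⟩ := h s (nonZeroDivisors.ne_zero hs)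
  have hc := ker_orbitHom_div_le hφ (r := r) (IsUnit.mk0 _ hne) (div_mul_cancel₀ _ hne)
  refine ⟨_, ?_, hc⟩
  -- Having trace one is itself a relation of the orbit, so it is inherited by the specialized
  -- element.
  have h1 : (∑ g : G, MvPolynomial.X g : MvPolynomial G k) - 1 ∈
      RingHom.ker (orbitHom (fracAct σ) _) :=
    orbitHom_dIdeal hb _ (Ideal.subset_span rfl)
  have h2 := hc h1
  rw [RingHom.mem_ker, map_sub, map_sum, map_one, sub_eq_zero] at h2
  simpa [IsPoint] using h2

theorem orbitHom_one {A : Type*} [CommRing A] [Algebra k A] (σ : G →* (A ≃ₐ[k] A))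
    (P : MvPolynomial G k) :
    orbitHom σ 1 P = algebraMap k A (MvPolynomial.aeval (fun _ => (1 : k)) P) := by
  have : orbitHom σ 1 = (Algebra.ofId k A).comp (MvPolynomial.aeval fun _ => (1 : k)) :=
    MvPolynomial.algHom_ext fun g => by simp
  rw [this]
  rfl

theorem specializes_of_subsingleton [Fintype G] [Subsingleton G] {A B : Type*} [CommRing A]
    [Algebra k A] [Nontrivial A] [CommRing B] [Algebra k B] (σ : G →* (A ≃ₐ[k] A))
    (τ : G →* (B ≃ₐ[k] B)) : Specializes σ τ := by
  have h1 : ∀ g : G, g = 1 := fun g => Subsingleton.elim g 1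
  have : Unique G := ⟨⟨1⟩, h1⟩
  intro b hb
  have hb1 : b = 1 := by
    unfold IsPoint at hb
    rw [Fintype.sum_unique, h1 default, map_one] at hb
    exact hb
  refine ⟨1, by simp [IsPoint], fun P hP => ?_⟩
  subst hb1
  rw [RingHom.mem_ker, orbitHom_one, map_eq_zero_iff _ (algebraMap k A).injective] at hP
  rw [RingHom.mem_ker, orbitHom_one, hP, map_zero]

end Dense

/-! ### Constants in rational function fields -/

section AlgClosed

variable {k : Type*} [Field k]

/-- The polynomial ring is integrally closed, so `x` is a polynomial. If nonzero, it is a unit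
because it is algebraic over a field, hence a constant. -/
theorem mem_range_algebraMap_of_isAlgebraic {I : Type*} {x : FractionRing (MvPolynomial I k)}
    (hx : IsAlgebraic k x) : x ∈ (algebraMap k (FractionRing (MvPolynomial I k))).range := by
  have h1 : IsIntegral (MvPolynomial I k) x := hx.isIntegral.tower_top
  obtain ⟨y, rfl⟩ := IsIntegrallyClosed.isIntegral_iff.1 h1
  have hy : IsIntegral k y := ((isAlgebraic_algebraMap_iff
    (IsFractionRing.injective (MvPolynomial I k) (FractionRing (MvPolynomial I k)))).1 hx).isIntegral
  rw [IsScalarTower.algebraMap_eq k (MvPolynomial I k), RingHom.mem_range]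
  by_cases h0 : y = 0
  · exact ⟨0, by simp [h0]⟩
  · obtain ⟨r, -, rfl⟩ := MvPolynomial.isUnit_iff_eq_C_of_isReduced.1 (hy.isUnit h0)
    exact ⟨r, rfl⟩

theorem infinite_of_not_isAlgebraic {K : Type*} [Field K] [Algebra k K]
    (h : ¬ Algebra.IsAlgebraic k K) : Infinite K := by
  by_contra hK
  rw [not_infinite_iff_finite] at hK
  exact h inferInstance

/-- Algebraic elements would be constants, on which the group acts trivially. -/
theorem not_isAlgebraic_of_embedding {G K I : Type*} [Group G] [Nontrivial G] [CommRing K]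
    [Algebra k K] {σ : G →* (K ≃ₐ[k] K)} (hσ : Function.Injective σ)
    (j : K →ₐ[k] FractionRing (MvPolynomial I k)) (hj : Function.Injective j) :
    ¬ Algebra.IsAlgebraic k K := by
  intro hK
  obtain ⟨g, hg⟩ := exists_ne (1 : G)
  refine hg (hσ (AlgEquiv.ext fun x => ?_))
  obtain ⟨r, hr⟩ := mem_range_algebraMap_of_isAlgebraic ((hK.isAlgebraic x).algHom j)
  obtain rfl : x = algebraMap k K r := hj (by rw [← hr, j.commutes])
  simp

end AlgClosed

/-! ### Density of polynomial rings and symmetric algebras -/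

section Dense

variable {k G K : Type*} [Field k] [Group G] [Field K] [Algebra k K]

theorem isDense_regAct [Finite G] [Infinite K] {τ : G →* (K ≃ₐ[k] K)}
    (hτ : Function.Injective τ) : IsDense (regAct k G) τ := by
  intro s hs
  have hs' : MvPolynomial.rename (fun g : G => (g, ())) s ≠ 0 := by
    rwa [Ne, map_eq_zero_iff _ (MvPolynomial.rename_injective _ fun a b h => by simpa using h)]
  obtain ⟨c, hc⟩ := exists_aeval_orbit_ne_zero hτ hs'
  rw [MvPolynomial.aeval_rename] at hc
  exact ⟨orbitHom τ (c ()), isEquivariant_orbitHom τ _, hc⟩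

/-- `W` embeds equivariantly in a sum of regular representations by recording in slot `g` the
coordinates of `g⁻¹ x`; reading slot `1` shows that the symmetric algebra stays embedded. Then the
orbit evaluation `X_{g,i} ↦ τ_g(c_i)` applies. -/
theorem isDense_symAct [Fintype G] [Infinite K] {W : Type*} [AddCommGroup W] [Module k W]
    [Module.Finite k W] [IsDomain (SymmetricAlgebra k W)] (ρ : Representation k G W)
    {τ : G →* (K ≃ₐ[k] K)} (hτ : Function.Injective τ) : IsDense (symAct ρ) τ := by
  classical
  intro s hs
  let B := Module.Free.chooseBasis k W
  let coord : W →ₗ[k] MvPolynomial (G × Module.Free.ChooseBasisIndex k W) k :=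
    ∑ g : G, B.constr k (fun i => MvPolynomial.X (g, i)) ∘ₗ ρ g⁻¹
  let f := SymmetricAlgebra.lift coord
  let f' : MvPolynomial (G × Module.Free.ChooseBasisIndex k W) k →ₐ[k] SymmetricAlgebra k W :=
    MvPolynomial.aeval fun x => if x.1 = 1 then SymmetricAlgebra.ι k W (B x.2) else 0
  have hf : ∀ x, f (SymmetricAlgebra.ι k W x) =
      ∑ g : G, B.constr k (fun i => MvPolynomial.X (g, i)) (ρ g⁻¹ x) := fun x => by
    rw [SymmetricAlgebra.lift_ι_apply]
    simp only [coord, LinearMap.sum_apply, LinearMap.comp_apply]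
  have hff' : f'.comp f = AlgHom.id k _ := by
    refine SymmetricAlgebra.algHom_ext (B.ext fun i => ?_)
    have : ∀ g : G, f'.toLinearMap ∘ₗ B.constr k (fun i => MvPolynomial.X (g, i)) =
        if g = 1 then SymmetricAlgebra.ι k W else 0 := fun g => B.ext fun i => by
      by_cases hg : g = 1 <;> simp [f', hg]
    have h2 : ∀ g x, f' (B.constr k (fun i => MvPolynomial.X (g, i)) x) =
      (if g = 1 then SymmetricAlgebra.ι k W else 0) x := fun g x => DFunLike.congr_fun (this g) x
    change f' (f (SymmetricAlgebra.ι k W (B i))) = SymmetricAlgebra.ι k W (B i)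
    rw [hf, map_sum, Finset.sum_eq_single 1 (fun g _ hg => by rw [h2, if_neg hg]; rfl) (by simp), h2,
      if_pos rfl, inv_one, map_one, Module.End.one_apply]
  have hfs : f s ≠ 0 := fun h0 => hs (by
    have := DFunLike.congr_fun hff' s
    rwa [AlgHom.comp_apply, h0, map_zero, AlgHom.id_apply, eq_comm] at this)
  obtain ⟨c, hc⟩ := exists_aeval_orbit_ne_zero hτ hfs
  let e : MvPolynomial (G × Module.Free.ChooseBasisIndex k W) k →ₐ[k] K :=
    MvPolynomial.aeval fun x => τ x.1 (c x.2)
  refine ⟨e.comp f, fun g a => ?_, hc⟩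
  have he : ∀ g x, e (B.constr k (fun i => MvPolynomial.X (g, i)) x) =
      τ g (B.constr k c x) := fun g x => by
    have : e.toLinearMap ∘ₗ B.constr k (fun i => MvPolynomial.X (g, i)) =
        (τ g : K →ₐ[k] K).toLinearMap ∘ₗ B.constr k c := B.ext fun i => by simp [e]
    exact DFunLike.congr_fun this x
  have : (e.comp f).comp (symAct ρ g : SymmetricAlgebra k W →ₐ[k] SymmetricAlgebra k W) =
      ((τ g : K →ₐ[k] K)).comp (e.comp f) := by
    refine SymmetricAlgebra.algHom_ext (LinearMap.ext fun x => ?_)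
    change e (f (symAct ρ g (SymmetricAlgebra.ι k W x))) =
      τ g (e (f (SymmetricAlgebra.ι k W x)))
    rw [symAct_ι, hf, hf, map_sum, map_sum, map_sum, ← Equiv.sum_comp (Equiv.mulLeft g)]
    refine Fintype.sum_congr _ _ fun h => ?_
    rw [he, he, Equiv.coe_mulLeft, ← Module.End.mul_apply, ← map_mul, map_mul τ]
    simp
  exact DFunLike.congr_fun this a

end Dense

/-! ### Embedding `D_k` into the rational function field -/

section D

variable (k G : Type*) [Field k] [Group G] [Fintype G]

theorem sum_X_ne_zero : (∑ g : G, MvPolynomial.X g : MvPolynomial G k) ≠ 0 := by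
  classical
  intro h
  have := congrArg (MvPolynomial.aeval (Pi.single 1 1 : G → k)) h
  simp at this

instance : Nontrivial (MvPolynomial G k ⧸ dIdeal k G) := by
  classical
  refine Ideal.Quotient.nontrivial_iff.2 fun h => ?_
  have h1 : (1 : MvPolynomial G k) ∈ dIdeal k G := h ▸ trivial
  obtain ⟨Q, hQ⟩ := Ideal.mem_span_singleton'.1 h1
  have := congrArg (MvPolynomial.aeval (Pi.single 1 1 : G → k)) hQ
  simp at this

theorem isPoint_X_div_sum : IsPoint (fracAct (regAct k G))
    (algebraMap (MvPolynomial G k) (FractionRing (MvPolynomial G k)) (MvPolynomial.X 1) /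
      algebraMap (MvPolynomial G k) (FractionRing (MvPolynomial G k))
        (∑ g : G, MvPolynomial.X g)) := by
  have hinv : ∀ g, regAct k G g (∑ h : G, MvPolynomial.X h) = ∑ h : G, MvPolynomial.X h := fun g => by
    simp only [map_sum, regAct_X]
    exact Equiv.sum_comp (Equiv.mulLeft g) fun h => (MvPolynomial.X h : MvPolynomial G k)
  unfold IsPoint
  simp only [map_div₀, fracAct_algebraMap, hinv, regAct_X, mul_one]
  rw [← Finset.sum_div, ← map_sum]
  refine div_self ?_
  rw [Ne, map_eq_zero_iff _ (IsFractionRing.injective _ _)]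
  exact sum_X_ne_zero k G

/-- The embedding of `D_k` into the field of rational functions in `X_g`, with
`X_g ↦ X_g / ∑ h, X_h`. -/
def dEmb : MvPolynomial G k ⧸ dIdeal k G →ₐ[k] FractionRing (MvPolynomial G k) :=
  pointHom (isPoint_X_div_sum k G)

theorem isEquivariant_dEmb : IsEquivariant
    (quotAct (regAct k G) (dIdeal k G) (dIdeal_stable k G)) (fracAct (regAct k G)) (dEmb k G) :=
  isEquivariant_pointHom _

/-- In `D_k` the sum of the variables becomes the unit `1`, so `X_1 / ∑ h, X_h` specializes to the
class of `X_1`. Every relation in the rational function field therefore already holds in `D_k`. -/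
theorem dEmb_injective : Function.Injective (dEmb k G) := by
  rw [injective_iff_map_eq_zero]
  intro a ha
  obtain ⟨P, rfl⟩ := Ideal.Quotient.mk_surjective a
  have hq := isEquivariant_quotient_mk (regAct k G) (dIdeal k G) (dIdeal_stable k G)
  have h1 : Ideal.Quotient.mkₐ k (dIdeal k G) (∑ h : G, MvPolynomial.X h) = 1 := by
    rw [← map_one (Ideal.Quotient.mkₐ k (dIdeal k G))]
    exact Ideal.Quotient.eq.2 (Ideal.subset_span rfl)
  have h2 := ker_orbitHom_div_le hq (r := MvPolynomial.X 1) (s := ∑ h : G, MvPolynomial.X h)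
    (by rw [h1]; exact isUnit_one) (by rw [h1, mul_one])
  have h3 := h2 (show P ∈ RingHom.ker _ from ha)
  rw [RingHom.mem_ker, ← comp_orbitHom hq, AlgHom.comp_apply] at h3
  rw [← h3]
  have : orbitHom (regAct k G) (MvPolynomial.X 1) = AlgHom.id k _ :=
    MvPolynomial.algHom_ext fun g => by simp
  rw [this]
  rfl

instance : IsDomain (MvPolynomial G k ⧸ dIdeal k G) :=
  (dEmb_injective k G).isDomain (dEmb k G).toRingHom

end D

/-! ### Essential dimension of `G`-fields -/

section EssDim

variable {k G K L A : Type*} [Field k] [Group G]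

theorem essDimField_le_trDeg [CommRing L] [Algebra k L] {τ : G →* (L ≃ₐ[k] L)} (hL : IsField L)
    (hτ : Function.Injective τ) : essDimField τ ≤ trDeg k L := by
  refine sInf_le ⟨⊤, MulEquiv.isField hL (Subalgebra.topEquiv (R := k) (A := L)).toMulEquiv,
    fun _ _ _ => trivial, fun g hg => hτ (AlgEquiv.ext fun x => ?_),
    trDeg_eq_of_algEquiv Subalgebra.topEquiv⟩
  rw [hg x trivial, map_one, AlgEquiv.one_apply]

theorem essDimField_le_of_isEquivariant [CommRing L] [Algebra k L] [CommRing K] [Algebra k K]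
    {τ : G →* (L ≃ₐ[k] L)} {σ : G →* (K ≃ₐ[k] K)} {j : L →ₐ[k] K} (hj : IsEquivariant τ σ j)
    (hi : Function.Injective j) : essDimField σ ≤ essDimField τ := by
  refine sInf_le_sInf ?_
  rintro _ ⟨E, hE, hs, hf, rfl⟩
  let e := E.equivMapOfInjective j hi
  refine ⟨E.map j, MulEquiv.isField hE e.symm.toMulEquiv, ?_, fun g hg => hf g fun x hx => hi ?_,
    trDeg_eq_of_algEquiv e.symm⟩
  · rintro g _ ⟨x, hx, rfl⟩
    exact ⟨τ g x, hs g x hx, hj g x⟩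
  · exact (hj g x).trans (hg _ ⟨x, hx, rfl⟩)

variable [Fintype G]

/-- A subfield attaining the minimum contains a point, together with its whole orbit. -/
theorem exists_isPoint_trDeg_le [CommRing K] [Algebra k K] {σ : G →* (K ≃ₐ[k] K)} (hK : IsField K)
    (hσ : Function.Injective σ) :
    ∃ b, IsPoint σ b ∧
      trDeg k (orbitHom σ b).range ≤ essDimField σ := by
  obtain ⟨E, hE, hs, hf, ht⟩ : essDimField σ ∈ _ := csInf_mem ⟨_, ⊤,
    MulEquiv.isField hK (Subalgebra.topEquiv (R := k) (A := K)).toMulEquiv,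
    fun _ _ _ => trivial, fun g hg => hσ (AlgEquiv.ext fun x => by
      rw [hg x trivial, map_one, AlgEquiv.one_apply]), rfl⟩
  obtain ⟨b, hb⟩ := exists_isPoint (subAct σ E hs) hE (by
    rw [injective_iff_map_eq_one]
    exact fun g hg => hf g fun x hx =>
      congrArg Subtype.val (DFunLike.congr_fun hg (⟨x, hx⟩ : E)))
  refine ⟨b, hb.map (isEquivariant_val σ E hs), ?_⟩
  rw [← ht]
  have hle : (orbitHom σ (E.val b)).range ≤ E := by
    rw [← comp_orbitHom (isEquivariant_val σ E hs)]
    rintro _ ⟨P, rfl⟩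
    exact Subtype.prop _
  exact trDeg_le_of_injective (Subalgebra.inclusion hle) (Subalgebra.inclusion_injective hle)

theorem trDeg_quotient_ker_le [CommRing A] [Algebra k A] [CommRing K] [Algebra k K] {f : A →ₐ[k] K}
    {S : Subalgebra k K} (h : f.range ≤ S) : trDeg k (A ⧸ RingHom.ker f) ≤ trDeg k S :=
  trDeg_le_of_injective ((Ideal.kerLiftAlg f).codRestrict S fun x => by
    obtain ⟨a, rfl⟩ := Ideal.Quotient.mk_surjective x
    exact h ⟨a, rfl⟩) fun _ _ hxy => Ideal.kerLiftAlg_injective f (congrArg Subtype.val hxy)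

variable {p n : ℕ} [Fact p.Prime] [CharP k p]

theorem essDimField_le_of_isPoint (hG : Nat.card G = p ^ n) [CommRing A] [Algebra k A]
    [IsDomain A] [Field K] [Algebra k K] {τ : G →* (A ≃ₐ[k] A)} {σ : G →* (K ≃ₐ[k] K)}
    {f : A →ₐ[k] K} (hf : IsEquivariant τ σ f) (hi : Function.Injective f) (hτ : ∃ a, IsPoint τ a) :
    essDimField σ ≤ trDeg k A := by
  obtain ⟨a, ha⟩ := hτ
  refine (essDimField_le_of_isEquivariant (hf.fracLift hi) (fracLift f hi).injective).trans ?_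
  refine (essDimField_le_trDeg (Field.toIsField _) (fracAct_injective (ha.injective hG))).trans ?_
  exact (trDeg_fractionRing (K := FractionRing A)).le

/-- The image of `f` contains a point, so its fraction field is a competitor for the minimum. -/
theorem essDimField_le_of_ker (hG : Nat.card G = p ^ n) [CommRing A] [Algebra k A]
    [Field K] [Algebra k K] {τ : G →* (A ≃ₐ[k] A)} {σ : G →* (K ≃ₐ[k] K)}
    {f : A →ₐ[k] K} (hf : IsEquivariant τ σ f) (hσ : ∃ a, IsPoint σ (f a)) :
    essDimField σ ≤ trDeg k (A ⧸ RingHom.ker f) := by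
  obtain ⟨a, ha⟩ := hσ
  have := RingHom.ker_isPrime f.toRingHom
  have : IsDomain (A ⧸ RingHom.ker f) := Ideal.Quotient.isDomain (RingHom.ker f.toRingHom)
  refine essDimField_le_of_isPoint hG (isEquivariant_kerLift hf) (Ideal.kerLiftAlg_injective f)
    ⟨Ideal.Quotient.mk _ a, IsPoint.of_map (isEquivariant_kerLift hf)
      (Ideal.kerLiftAlg_injective f) ?_⟩
  rwa [Ideal.kerLiftAlg_mk]

theorem essDimField_le_of_specializes (hG : Nat.card G = p ^ n) [CommRing L] [Algebra k L]
    [Field K] [Algebra k K] {τ : G →* (L ≃ₐ[k] L)} {σ : G →* (K ≃ₐ[k] K)} (hL : IsField L)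
    (hτ : Function.Injective τ) (h : Specializes τ σ) : essDimField σ ≤ essDimField τ := by
  obtain ⟨b, hb, ht⟩ := exists_isPoint_trDeg_le hL hτ
  obtain ⟨c, hc, hle⟩ := h b hb
  refine le_trans ?_ ((trDeg_quotient_ker_le le_rfl).trans ht)
  refine (essDimField_le_of_ker hG (isEquivariant_orbitHom σ c)
    ⟨MvPolynomial.X 1, by simpa using hc⟩).trans ?_
  exact trDeg_le_of_surjective (Ideal.Quotient.factorₐ k hle) (Ideal.Quotient.factor_surjective hle)

end EssDim

/-! ### Stable subalgebras with few generators -/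

theorem sum_zmod_pow_eq_neg_one (p : ℕ) [Fact p.Prime] : ∑ i : ZMod p, i ^ (p - 1) = -1 := by
  classical
  have hp := (Fact.out : p.Prime).one_lt
  have : ∀ i : ZMod p, i ^ (p - 1) = if i = 0 then 0 else 1 := fun i => by
    split_ifs with h
    · rw [h, zero_pow (by omega)]
    · exact ZMod.pow_card_sub_one_eq_one h
  simp only [this]
  rw [Finset.sum_ite, Finset.sum_const_zero, zero_add, Finset.sum_const, Finset.filter_ne' _ 0,
    Finset.card_erase_of_mem (Finset.mem_univ _), Finset.card_univ, ZMod.card, nsmul_eq_mul,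
    mul_one, Nat.cast_sub hp.le]
  simp

/-- After binomial expansion, the power sums over `ZMod p` of exponent below `p - 1` vanish; only
the term free of `x` survives. -/
theorem sum_add_natCast_pow {A : Type*} [CommRing A] (p : ℕ) [Fact p.Prime] [CharP A p] (x : A) :
    ∑ i ∈ Finset.range p, (x + i) ^ (p - 1) = -1 := by
  have hp := (Fact.out : p.Prime).one_lt
  let c := ZMod.castHom (dvd_refl p) A
  have h1 : ∑ i ∈ Finset.range p, (x + i) ^ (p - 1) = ∑ i : ZMod p, (x + c i) ^ (p - 1) := by
    refine Finset.sum_nbij' (fun i => (i : ZMod p)) ZMod.val (by simp)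
      (fun i _ => Finset.mem_range.2 (ZMod.val_lt i))
      (fun i hi => ZMod.val_natCast_of_lt (Finset.mem_range.1 hi)) (by simp) (by simp [c])
  rw [h1]
  simp only [add_pow]
  rw [Finset.sum_comm, Finset.sum_eq_single 0]
  · simp only [pow_zero, one_mul, Nat.choose_zero_right, Nat.cast_one, mul_one, Nat.sub_zero]
    rw [show (-1 : A) = c (-1) by simp, ← sum_zmod_pow_eq_neg_one, map_sum]
    simp
  · intro m hm hm0
    rw [← Finset.sum_mul, ← Finset.mul_sum]
    have : ∑ i : ZMod p, c i ^ (p - 1 - m) = 0 := by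
      simp only [← map_pow, ← map_sum]
      rw [FiniteField.sum_pow_lt_card_sub_one, map_zero]
      rw [ZMod.card]
      omega
    rw [this, mul_zero, zero_mul]
  · intro h
    exact absurd (Finset.mem_range.2 (by omega)) h

theorem sum_zpowers {G M : Type*} [Group G] [Finite G] [AddCommMonoid M] (z : G)
    [Fintype (Subgroup.zpowers z)] (f : G → M) :
    ∑ w : Subgroup.zpowers z, f w = ∑ i ∈ Finset.range (orderOf z), f (z ^ i) := by
  rw [Finset.sum_range]
  exact (Fintype.sum_equiv (finEquivZPowers (isOfFinOrder_of_finite z)) _ _ fun i => by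
    simp [finEquivZPowers_apply]).symm

theorem exists_central_orderOf_eq {G : Type*} [Group G] [Finite G] {p n : ℕ} [Fact p.Prime]
    (hG : Nat.card G = p ^ (n + 1)) : ∃ z ∈ Subgroup.center G, orderOf z = p := by
  have hp := IsPGroup.of_card hG
  have : Nontrivial G := Finite.one_lt_card_iff_nontrivial.1 (by
    rw [hG]
    exact Nat.one_lt_pow (by omega) (Fact.out : p.Prime).one_lt)
  have := hp.center_nontrivial
  have hdvd : p ∣ Nat.card (Subgroup.center G) :=
    (hp.to_subgroup _).card_eq_or_dvd.resolve_left Finite.one_lt_card.ne'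
  obtain ⟨z, hz⟩ := exists_prime_orderOf_dvd_card' p hdvd
  exact ⟨z, z.2, by rwa [Subgroup.orderOf_coe]⟩

section Quotient

variable {k G A : Type*} [Field k] [Group G] [CommRing A] [Algebra k A]

/-- The subalgebra of invariants under the subgroup `N`. -/
def fixedSubalgebra (σ : G →* (A ≃ₐ[k] A)) (N : Subgroup G) : Subalgebra k A where
  carrier := {a | ∀ z ∈ N, σ z a = a}
  mul_mem' ha hb z hz := by rw [map_mul, ha z hz, hb z hz]
  add_mem' ha hb z hz := by rw [map_add, ha z hz, hb z hz]
  algebraMap_mem' r z _ := (σ z).commutes r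

theorem fixedSubalgebra_stable (σ : G →* (A ≃ₐ[k] A)) (N : Subgroup G) [hN : N.Normal] (g : G)
    (a : A) (ha : a ∈ fixedSubalgebra σ N) : σ g a ∈ fixedSubalgebra σ N := by
  intro z hz
  have h1 := ha _ (hN.conj_mem z hz g⁻¹)
  rw [inv_inv] at h1
  rw [← AlgEquiv.mul_apply, ← map_mul, show z * g = g * (g⁻¹ * z * g) by group, map_mul,
    AlgEquiv.mul_apply, h1]

/-- The action of `G ⧸ N` on the `N`-invariants. -/
def quotientGroupAct (σ : G →* (A ≃ₐ[k] A)) (N : Subgroup G) [N.Normal] :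
    (G ⧸ N) →* (fixedSubalgebra σ N ≃ₐ[k] fixedSubalgebra σ N) :=
  QuotientGroup.lift N (subAct σ (fixedSubalgebra σ N) (fixedSubalgebra_stable σ N))
    fun z hz => AlgEquiv.ext fun a => Subtype.ext (a.2 z hz)

theorem coe_quotientGroupAct_out (σ : G →* (A ≃ₐ[k] A)) (N : Subgroup G) [N.Normal] (q : G ⧸ N)
    (a : fixedSubalgebra σ N) : (quotientGroupAct σ N q a : A) = σ q.out a := by
  conv_lhs => rw [← QuotientGroup.out_eq' q]
  rfl

end Quotient

/-- The additive Artin–Schreier step: a point of the invariants of a central subgroup of order `p`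
in a stable subalgebra extends to a point after adjoining one more element. -/
theorem exists_stable_adjoin_insert {k G A : Type*} [Field k] [Group G] [Fintype G] [CommRing A]
    [Algebra k A] {p : ℕ} [Fact p.Prime] [CharP A p] {σ : G →* (A ≃ₐ[k] A)} {a : A}
    (ha : IsPoint σ a) {z : G} (hz : z ∈ Subgroup.center G) (hzp : orderOf z = p)
    {Z : Subgroup G} [Z.Normal] [Fintype (G ⧸ Z)] (hZ : Subgroup.zpowers z = Z) {C : Subalgebra k A}
    (hC : ∀ g : G, ∀ c ∈ C, σ g c ∈ C) {y : A} (hyC : y ∈ C) (hyz : σ z y = y)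
    (hy : ∑ q : G ⧸ Z, σ q.out y = 1) :
    ∃ x : A, (∀ g : G, σ g x - x ∈ C) ∧ IsPoint σ (-x ^ (p - 1) * y) := by
  classical
  have hsum : ∀ f : G → A, ∑ w : Z, f w = ∑ i ∈ Finset.range p, f (z ^ i) := by
    subst hZ
    rw [← hzp]
    exact sum_zpowers z
  have hcomm : ∀ g : G, g * z = z * g := fun g => Subgroup.mem_center_iff.1 hz g
  have hcommp : ∀ (g : G) (i : ℕ), g * z ^ i = z ^ i * g := fun g i =>
    (Commute.pow_right (hcomm g) i : _)
  let tr (b : A) : A := ∑ i ∈ Finset.range p, σ (z ^ i) b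
  have hstage : ∀ b, ∑ g : G, σ g b = ∑ q : G ⧸ Z, σ q.out (tr b) := fun b => by
    rw [sum_eq_sum_quotient Z]
    refine Fintype.sum_congr _ _ fun q => ?_
    rw [hsum (fun w => σ (q.out * w) b), map_sum]
    simp
  have hstage' : ∀ b, ∑ g : G, σ g b = tr (∑ q : G ⧸ Z, σ q.out b) := fun b => by
    rw [hstage]
    simp only [tr, map_sum]
    rw [Finset.sum_comm]
    refine Finset.sum_congr rfl fun i _ => Finset.sum_congr rfl fun q _ => ?_
    rw [← AlgEquiv.mul_apply, ← AlgEquiv.mul_apply, ← map_mul, ← map_mul, hcommp]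
  have hzp1 : z ^ p = 1 := hzp ▸ pow_orderOf_eq_one z
  -- an element with `σ z t = t + 1`
  obtain ⟨t, ht⟩ : ∃ t, σ z t = t + 1 := by
    let a' := ∑ q : G ⧸ Z, σ q.out a
    have ha' : tr a' = 1 := by rw [← hstage']; exact ha
    -- Additive Hilbert 90: applying `σ z` shifts the index, and the discrepancy is the trace of
    -- `a'` over the powers of `z`, which is one. The wrap-around term has coefficient `p = 0`.
    refine ⟨-∑ i ∈ Finset.range p, (i : A) * σ (z ^ i) a', ?_⟩
    have hsucc : ∀ i : ℕ, σ z (σ (z ^ i) a') = σ (z ^ (i + 1)) a' := fun i => by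
      rw [pow_succ', map_mul, AlgEquiv.mul_apply]
    have e1 : ∑ i ∈ Finset.range p, ((i + 1 : ℕ) : A) * σ (z ^ (i + 1)) a' =
        ∑ i ∈ Finset.range p, (i : A) * σ (z ^ i) a' := by
      have h1 := Finset.sum_range_succ (fun i : ℕ => (i : A) * σ (z ^ i) a') p
      rw [Finset.sum_range_succ'] at h1
      simpa using h1
    have e2 : ∑ i ∈ Finset.range p, σ (z ^ (i + 1)) a' = 1 := by
      have h1 := Finset.sum_range_succ (fun i : ℕ => σ (z ^ i) a') p
      rw [Finset.sum_range_succ'] at h1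
      rw [hzp1, pow_zero] at h1
      exact (add_right_cancel h1).trans ha'
    rw [map_neg, map_sum]
    simp only [map_mul, map_natCast, hsucc]
    rw [← e1]
    simp only [Nat.cast_add, Nat.cast_one, add_mul, one_mul, Finset.sum_add_distrib, e2]
    ring
  have htp : ∀ i : ℕ, σ (z ^ i) t = t + i := fun i => by
    induction i with
    | zero => simp
    | succ i ih => rw [pow_succ', map_mul, AlgEquiv.mul_apply, ih, map_add, map_natCast, ht]
                   push_cast; ring
  have hyp : ∀ i : ℕ, σ (z ^ i) y = y := fun i => by
    induction i with
    | zero => simp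
    | succ i ih => rw [pow_succ', map_mul, AlgEquiv.mul_apply, ih, hyz]
  -- Weighting `t` by `y`, whose coset sum is one, keeps the translation by one under `z` and makes
  -- the displacement under every `g` lie in `C`.
  let x := ∑ q : G ⧸ Z, σ q.out (y * t)
  have hxz : σ z x = x + 1 := by
    simp only [x, map_sum]
    rw [← hy, ← Finset.sum_add_distrib]
    refine Fintype.sum_congr _ _ fun q => ?_
    rw [← AlgEquiv.mul_apply, ← map_mul, ← hcomm, map_mul σ, AlgEquiv.mul_apply, map_mul (σ z), hyz,
      ht, ← map_add]
    ring_nf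
  have hxp : ∀ i : ℕ, σ (z ^ i) x = x + i := fun i => by
    induction i with
    | zero => simp
    | succ i ih => rw [pow_succ', map_mul, AlgEquiv.mul_apply, ih, map_add, map_natCast, hxz]
                   push_cast; ring
  refine ⟨x, fun g => ?_, ?_⟩
  -- `g` permutes the coset representatives up to powers of `z`, and `z ^ i` adds `i` to `t`; the
  -- displacement is an integer combination of conjugates of `y`.
  · have hdec : ∀ q : G ⧸ Z, ∃ i : ℕ, g * q.out = ((g : G ⧸ Z) * q).out * z ^ i := fun q => by
      have hmem : (((g : G ⧸ Z) * q).out)⁻¹ * (g * q.out) ∈ Z := by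
        rw [← QuotientGroup.eq]
        simp
      obtain ⟨i, hi⟩ := (mem_powers_iff_mem_zpowers (x := z)).2 (by rw [hZ]; exact hmem)
      refine ⟨i, ?_⟩
      change z ^ i = _ at hi
      rw [hi]
      group
    choose i hi using hdec
    have h1 : σ g x = x + ∑ q : G ⧸ Z, (i q : A) * σ ((g : G ⧸ Z) * q).out y := by
      have h2 : x = ∑ q : G ⧸ Z, σ ((g : G ⧸ Z) * q).out (y * t) :=
        (Equiv.sum_comp (Equiv.mulLeft (g : G ⧸ Z)) fun q => σ q.out (y * t)).symm
      conv_rhs => rw [h2]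
      rw [← Finset.sum_add_distrib, map_sum]
      refine Fintype.sum_congr _ _ fun q => ?_
      rw [← AlgEquiv.mul_apply, ← map_mul, hi, map_mul σ, AlgEquiv.mul_apply, map_mul (σ (z ^ i q)),
        hyp, htp]
      simp only [map_mul, map_add, map_natCast]
      ring
    rw [h1, add_sub_cancel_left]
    exact sum_mem fun q _ => mul_mem (natCast_mem C _) (hC _ _ hyC)
  -- The trace over the powers of `z` sends `-x ^ (p - 1) * y` to `y`, whose coset sum is one.
  · unfold IsPoint
    rw [hstage, ← hy]
    refine Fintype.sum_congr _ _ fun q => congrArg (σ q.out) ?_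
    have hv : ∀ i : ℕ, σ (z ^ i) (-x ^ (p - 1) * y) = -(x + i) ^ (p - 1) * y := fun i => by
      rw [map_mul (σ (z ^ i)), map_neg, map_pow (σ (z ^ i)), hxp, hyp]
    simp only [tr, hv]
    rw [← Finset.sum_mul, Finset.sum_neg_distrib, sum_add_natCast_pow, neg_neg, one_mul]

/-- Induction on `n`: divide by a central subgroup of order `p`, apply the induction hypothesis to
its invariants, and adjoin one Artin–Schreier element. -/
theorem exists_stable_adjoin_range {k : Type*} [Field k] {p : ℕ} [Fact p.Prime] [CharP k p] (n : ℕ) :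
    ∀ {G : Type u} [Group G] [Fintype G], Nat.card G = p ^ n →
    ∀ {A : Type v} [CommRing A] [Nontrivial A] [Algebra k A] (σ : G →* (A ≃ₐ[k] A)),
      (∃ a, IsPoint σ a) → ∃ x : Fin n → A,
        (∀ g : G, ∀ c ∈ Algebra.adjoin k (Set.range x), σ g c ∈ Algebra.adjoin k (Set.range x)) ∧
        ∃ y ∈ Algebra.adjoin k (Set.range x), IsPoint σ y := by
  classical
  induction n with
  | zero =>
    intro G _ _ hG A _ _ _ σ _
    have : Subsingleton G := (Nat.card_eq_one_iff_unique.1 (by simpa using hG)).1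
    have h1 : ∀ g : G, g = 1 := fun g => Subsingleton.elim g 1
    have : Unique G := ⟨⟨1⟩, h1⟩
    refine ⟨Fin.elim0, fun g c hc => ?_, 1, one_mem _, by simp [IsPoint]⟩
    rwa [h1 g, map_one, AlgEquiv.one_apply]
  | succ n ih =>
    rintro G _ _ hG A _ _ _ σ ⟨a, ha⟩
    have : CharP A p := charP_of_injective_algebraMap (algebraMap k A).injective p
    obtain ⟨z, hz, hzp⟩ := exists_central_orderOf_eq hG
    let Z := Subgroup.zpowers z
    have hZ : Z.Normal := ⟨fun w hw g => by
      have : w ∈ Subgroup.center G := (Subgroup.zpowers_le.2 hz) hw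
      rw [Subgroup.mem_center_iff.1 this g, mul_inv_cancel_right]
      exact hw⟩
    have hcard : Nat.card (G ⧸ Z) = p ^ n := by
      have h1 := Subgroup.card_eq_card_quotient_mul_card_subgroup Z
      rw [hG, Nat.card_zpowers, hzp, pow_succ] at h1
      exact (Nat.eq_of_mul_eq_mul_right (Fact.out : p.Prime).pos h1).symm
    -- By transitivity of the trace, this partial trace is a point for `G ⧸ Z`.
    have hfix : ∑ w : Z, σ w a ∈ fixedSubalgebra σ Z := fun w hw => by
      rw [map_sum, ← Equiv.sum_comp (Equiv.mulLeft (⟨w, hw⟩ : Z)) fun v : Z => σ v a]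
      simp
    obtain ⟨x, hx, y, hy, hyp⟩ := ih hcard (quotientGroupAct σ Z) ⟨⟨_, hfix⟩, by
      apply Subtype.ext
      rw [AddSubmonoidClass.coe_finsetSum]
      simp only [coe_quotientGroupAct_out]
      change _ = (1 : A)
      rw [← show ∑ g : G, σ g a = 1 from ha, sum_eq_sum_quotient Z]
      simp⟩
    let C : Subalgebra k A := Algebra.adjoin k (Set.range fun i => (x i : A))
    have hCmap : C = (Algebra.adjoin k (Set.range x)).map (fixedSubalgebra σ Z).val := by
      rw [AlgHom.map_adjoin, ← Set.range_comp]
      rfl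
    have hC : ∀ g : G, ∀ c ∈ C, σ g c ∈ C := by
      rw [hCmap]
      rintro g _ ⟨c, hc, rfl⟩
      exact ⟨_, hx (g : G ⧸ Z) c hc, rfl⟩
    have hyC : (y : A) ∈ C := by
      rw [hCmap]
      exact ⟨y, hy, rfl⟩
    obtain ⟨t, ht, hpt⟩ := exists_stable_adjoin_insert ha hz hzp (Z := Z) rfl hC hyC
      (y.2 z (Subgroup.mem_zpowers z)) (by
        have := congrArg Subtype.val hyp
        rw [AddSubmonoidClass.coe_finsetSum] at this
        simp only [coe_quotientGroupAct_out] at this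
        exact this)
    refine ⟨Fin.cons t fun i => (x i : A), ?_⟩
    rw [Fin.range_cons]
    have hle : C ≤ Algebra.adjoin k (insert t (Set.range fun i => (x i : A))) :=
      Algebra.adjoin_mono (Set.subset_insert _ _)
    have htm : t ∈ Algebra.adjoin k (insert t (Set.range fun i => (x i : A))) :=
      Algebra.subset_adjoin (Set.mem_insert _ _)
    refine ⟨adjoin_stable σ ?_, _, mul_mem (neg_mem (pow_mem htm _)) (hle hyC), hpt⟩
    rintro g c (rfl | hc)
    · have := add_mem (hle (ht g)) htm
      rwa [sub_add_cancel] at this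
    · exact hle (hC g c (Algebra.subset_adjoin hc))

/-! ### The field of fractions of the symmetric algebra -/

section Sym

variable {k G V : Type*} [Field k] [Group G] [AddCommGroup V] [Module k V]

theorem ι_injective : Function.Injective (SymmetricAlgebra.ι k V) := by
  rw [injective_iff_map_eq_zero]
  intro x hx
  refine (Module.forall_dual_apply_eq_zero_iff k x).1 fun φ => ?_
  rw [← SymmetricAlgebra.lift_ι_apply φ x, hx, map_zero]

theorem symAct_injective {ρ : Representation k G V} (h : Function.Injective ρ) :
    Function.Injective (symAct ρ) := fun g g' hg => h <| LinearMap.ext fun x => ι_injective <| by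
  rw [← symAct_ι, ← symAct_ι, hg]

theorem dual_injective [Module.Finite k V] {ρ : Representation k G V} (h : Function.Injective ρ) :
    Function.Injective ρ.dual := fun g g' hg => by
  rw [Representation.dual_apply, Representation.dual_apply] at hg
  exact inv_injective (h ((Module.dualMap_dualMap_eq_iff k V).1 (congrArg LinearMap.dualMap hg)))

theorem infinite_symmetricAlgebra [Nontrivial V] : Infinite (SymmetricAlgebra k V) := by
  let B := Module.Free.chooseBasis k V
  have : Nonempty (Module.Free.ChooseBasisIndex k V) := B.index_nonempty
  exact Infinite.of_injective _ (SymmetricAlgebra.equivMvPolynomial B).symm.injective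

theorem fracAct_symAct_dual_injective {ρ : Representation k G V} [Module.Finite k V]
    (hρ : Function.Injective ρ) : Function.Injective (fracAct (symAct ρ.dual)) :=
  fracAct_injective (symAct_injective (dual_injective hρ))

theorem infinite_fractionRing_symmetricAlgebra {ρ : Representation k G V}
    (hρ : Function.Injective ρ) [Nontrivial G] :
    Infinite (FractionRing (SymmetricAlgebra k (Module.Dual k V))) := by
  have : Nontrivial V := by
    by_contra hV
    rw [not_nontrivial_iff_subsingleton] at hV
    obtain ⟨g, hg⟩ := exists_ne (1 : G)
    exact hg (hρ (LinearMap.ext fun x => Subsingleton.elim _ _))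
  have : Infinite (SymmetricAlgebra k (Module.Dual k V)) := infinite_symmetricAlgebra
  exact Infinite.of_injective _ (IsFractionRing.injective
    (SymmetricAlgebra k (Module.Dual k V)) (FractionRing (SymmetricAlgebra k (Module.Dual k V))))

end Sym

/-! ### Universal algebras embedded in `D_k` -/

section Universal

variable {k G : Type u} [Field k] [Group G] [Fintype G]

instance : IsDomain (Ts.D k G).carrier :=
  inferInstanceAs (IsDomain (MvPolynomial G k ⧸ dIdeal k G))

theorem EmbedsInD.isDomain {U : Ts k G} (h : EmbedsInD U) : IsDomain U.carrier := by
  obtain ⟨f, hf⟩ := h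
  exact hf.isDomain f.toAlgHom.toRingHom

theorem EmbedsInD.exists_embedding {U : Ts k G} (h : EmbedsInD U) :
    ∃ j : FractionRing U.carrier →ₐ[k] FractionRing (MvPolynomial G k),
      IsEquivariant (fracAct U.act) (fracAct (regAct k G)) j ∧ Function.Injective j := by
  have := h.isDomain
  obtain ⟨f, hf⟩ := h
  have he := (isEquivariant_dEmb k G).comp f.isEquivariant
  have hi : Function.Injective ((dEmb k G).comp f.toAlgHom) := (dEmb_injective k G).comp hf
  exact ⟨_, he.fracLift hi, (fracLift _ hi).injective⟩

theorem IsUniversal.exists_hom {U : Ts k G} (h : IsUniversal U) {B : Type*} [CommRing B]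
    [Algebra k B] {τ : G →* (B ≃ₐ[k] B)} {b : B} (hb : IsPoint τ b) :
    ∃ f : U.carrier →ₐ[k] MvPolynomial G k ⧸ dIdeal k G,
      IsEquivariant U.act τ ((pointHom hb).comp f) := by
  obtain ⟨f⟩ := isUniversal_iff.1 h
  exact ⟨f.toAlgHom, (isEquivariant_pointHom hb).comp f.isEquivariant⟩

theorem isUniversal_of_hom {A B : Ts k G} (h : IsUniversal A) (f : Ts.Hom B A) : IsUniversal B :=
  fun C => (h C).map fun g => Ts.Hom.comp g f

/-- The morphism from the quotient by the kernel. -/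
def Ts.Hom.kerLift {A B : Ts k G} (f : Ts.Hom A B) :
    Ts.Hom (A.quot (RingHom.ker f.toAlgHom) f.isEquivariant.ker_stable) B :=
  ⟨Ideal.kerLiftAlg f.toAlgHom, isEquivariant_kerLift f.isEquivariant⟩

theorem Ts.Hom.kerLift_injective {A B : Ts k G} (f : Ts.Hom A B) :
    Function.Injective f.kerLift.toAlgHom :=
  Ideal.kerLiftAlg_injective f.toAlgHom

/-- The projection to the quotient by the kernel. -/
def Ts.Hom.kerProj {A B : Ts k G} (f : Ts.Hom A B) :
    Ts.Hom A (A.quot (RingHom.ker f.toAlgHom) f.isEquivariant.ker_stable) :=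
  ⟨Ideal.Quotient.mkₐ k _, fun _ _ => rfl⟩

theorem Ts.Hom.kerProj_surjective {A B : Ts k G} (f : Ts.Hom A B) :
    Function.Surjective f.kerProj.toAlgHom :=
  Ideal.Quotient.mk_surjective

theorem EmbedsInD.of_injective {A B : Ts k G} (h : EmbedsInD B) (f : Ts.Hom A B)
    (hf : Function.Injective f.toAlgHom) : EmbedsInD A := by
  obtain ⟨g, hg⟩ := h
  exact ⟨g.comp f, hg.comp hf⟩

theorem isEquivariant_pow {A : Ts k G} {θ : A.carrier →ₐ[k] A.carrier}
    (h : IsEquivariant A.act A.act θ) (m : ℕ) : IsEquivariant A.act A.act (θ ^ m) := by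
  induction m with
  | zero => exact fun _ _ => rfl
  | succ m ih => exact ih.comp h

/-- Let `θ` be the composite `B → D_k → B`. By Noetherianity the kernels of its powers stabilize, so
`B → D_k` is injective on the image of some `θ ^ m`. Minimality embeds `B` into that image. -/
theorem IsBasic.embedsInD {B : Ts k G} (hB : IsBasic B) : EmbedsInD B := by
  obtain ⟨f⟩ := isUniversal_iff.1 hB.1
  obtain ⟨f'⟩ := B.nonempty_hom_of_D
  let θ : B.carrier →ₐ[k] B.carrier := f'.toAlgHom.comp f.toAlgHom
  have hθ : IsEquivariant B.act B.act θ := f'.isEquivariant.comp f.isEquivariant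
  have hle : ∀ m, RingHom.ker (θ ^ m) ≤ RingHom.ker (θ ^ (m + 1)) := fun m x hx => by
    rw [RingHom.mem_ker] at hx ⊢
    rw [pow_succ', AlgHom.mul_apply, hx, map_zero]
  have := B.finiteType
  have : IsNoetherianRing B.carrier := Algebra.FiniteType.isNoetherianRing k B.carrier
  obtain ⟨m, hm⟩ := monotone_stabilizes_iff_noetherian.2 this
    ⟨fun m => RingHom.ker (θ ^ m), monotone_nat_of_le_succ hle⟩
  have hm' : RingHom.ker (θ ^ m) = RingHom.ker (θ ^ (m + 1)) := hm (m + 1) (Nat.le_succ m)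
  let e : Ts.Hom B B := ⟨θ ^ m, isEquivariant_pow hθ m⟩
  obtain ⟨i, hi⟩ := prec_iff.1 (hB.2 _ (prec_iff.2 ⟨e.kerLift, e.kerLift_injective⟩))
  refine EmbedsInD.of_injective ?_ i hi
  refine ⟨(f.comp e.kerLift), ?_⟩
  rw [injective_iff_map_eq_zero]
  intro x hx
  obtain ⟨a, rfl⟩ := e.kerProj_surjective x
  have h1 : f.toAlgHom ((θ ^ m) a) = 0 := hx
  have h2 : a ∈ RingHom.ker (θ ^ (m + 1)) := by
    rw [RingHom.mem_ker, pow_succ', AlgHom.mul_apply]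
    change f'.toAlgHom (f.toAlgHom ((θ ^ m) a)) = 0
    rw [h1, map_zero]
  rw [← hm'] at h2
  exact Ideal.Quotient.eq_zero_iff_mem.2 h2

theorem exists_isUniversal_minimal (k G : Type u) [Field k] [Group G] [Fintype G] :
    ∃ d : ℕ, (∃ U : Ts k G, IsUniversal U ∧ EmbedsInD U ∧ trDeg k U.carrier = d) ∧
      ∀ U : Ts k G, IsUniversal U → EmbedsInD U → d ≤ trDeg k U.carrier := by
  let S : Set ℕ∞ := {t | ∃ U : Ts k G, IsUniversal U ∧ EmbedsInD U ∧ trDeg k U.carrier = t}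
  have hS : S.Nonempty := ⟨_, Ts.D k G, fun A => A.nonempty_hom_of_D,
    ⟨⟨AlgHom.id k _, fun _ _ => rfl⟩, Function.injective_id⟩, rfl⟩
  obtain ⟨U, hU, hUD, ht⟩ := csInf_mem hS
  have := U.finiteType
  obtain ⟨d, hd⟩ := ENat.ne_top_iff_exists.1 (trDeg_ne_top (k := k) (A := U.carrier))
  refine ⟨d, ⟨U, hU, hUD, hd.symm⟩, fun U' hU' hUD' => ?_⟩
  rw [hd, ht]
  exact csInf_le (OrderBot.bddBelow S) ⟨U', hU', hUD', rfl⟩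

/-- If `A` embeds in `U`, the image of `U` in `A` is again universal and inside `D_k`; least
transcendence degree makes `U → A` injective. -/
theorem isBasic_of_trDeg_le {U : Ts k G} (hU : IsUniversal U) (hUD : EmbedsInD U)
    (h : ∀ U' : Ts k G, IsUniversal U' → EmbedsInD U' → trDeg k U.carrier ≤ trDeg k U'.carrier) :
    IsBasic U := by
  refine ⟨hU, fun A hA => ?_⟩
  obtain ⟨i, hi⟩ := prec_iff.1 hA
  obtain ⟨g⟩ := hU A
  have h1 : IsUniversal (U.quot _ g.isEquivariant.ker_stable) :=
    isUniversal_of_hom hU (i.comp g.kerLift)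
  have h2 : EmbedsInD (U.quot _ g.isEquivariant.ker_stable) :=
    hUD.of_injective (i.comp g.kerLift) (hi.comp g.kerLift_injective)
  have := hUD.isDomain
  have := h2.isDomain
  have := U.finiteType
  have h3 := injective_of_surjective_of_trDeg_le _ g.kerProj_surjective (h _ h1 h2)
  exact prec_iff.2 ⟨g.kerLift.comp g.kerProj, g.kerLift_injective.comp h3⟩

/-- The image of `U` in `B` is a subobject, so by minimality `B` embeds in this quotient of `U`. -/
theorem IsBasic.trDeg_le {B U : Ts k G} (hB : IsBasic B) (hU : IsUniversal U) :
    trDeg k B.carrier ≤ trDeg k U.carrier := by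
  obtain ⟨g⟩ := hU B
  obtain ⟨i, hi⟩ := prec_iff.1 (hB.2 _ (prec_iff.2 ⟨g.kerLift, g.kerLift_injective⟩))
  exact (trDeg_le_of_injective _ hi).trans (trDeg_le_of_surjective _ g.kerProj_surjective)

theorem exists_isUniversal_trDeg_le {p n : ℕ} [Fact p.Prime] [CharP k p]
    (hG : Nat.card G = p ^ n) :
    ∃ U : Ts k G, IsUniversal U ∧ EmbedsInD U ∧ trDeg k U.carrier ≤ n := by
  obtain ⟨x, hx, y, hy, hyp⟩ := exists_stable_adjoin_range (k := k) n hG (Ts.D k G).act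
    (Ts.D k G).exists_isPoint
  have hfg : Algebra.FiniteType k (Algebra.adjoin k (Set.range x)) :=
    (Algebra.adjoin k (Set.range x)).fg_iff_finiteType.1
      (Subalgebra.fg_def.2 ⟨_, Set.finite_range x, rfl⟩)
  let U : Ts k G := Ts.ofPoint (subAct _ _ hx) hfg
    ⟨⟨y, hy⟩, IsPoint.of_map (isEquivariant_val _ _ hx) Subtype.val_injective hyp⟩
  let i : Ts.Hom U (Ts.D k G) := ⟨(Algebra.adjoin k (Set.range x)).val, fun _ _ => rfl⟩
  refine ⟨U, isUniversal_iff.2 ⟨i⟩, ⟨i, Subtype.val_injective⟩, ?_⟩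
  have h1 : ∀ S : Subalgebra k (Ts.D k G).carrier, S = (MvPolynomial.aeval x).range →
      trDeg k S ≤ n := by
    rintro _ rfl
    rw [← trDeg_mvPolynomial_fin (k := k) n]
    exact trDeg_le_of_surjective _ (AlgHom.rangeRestrict_surjective _)
  exact h1 _ (Algebra.adjoin_range_eq_range_aeval k x)

theorem exists_isDomain_minimal (k G : Type u) [Field k] [Group G] [Fintype G] :
    ∃ δ : ℕ, (∃ C : Ts k G, IsCyclicTs C ∧ IsDomain C.carrier ∧ trDeg k C.carrier = δ) ∧
      ∀ C : Ts k G, IsDomain C.carrier → δ ≤ trDeg k C.carrier := by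
  let S : Set ℕ∞ := {t | ∃ C : Ts k G, IsDomain C.carrier ∧ trDeg k C.carrier = t}
  have hS : S.Nonempty := ⟨_, Ts.D k G, inferInstance, rfl⟩
  obtain ⟨C, hC, ht⟩ := csInf_mem hS
  have hmin : ∀ C' : Ts k G, IsDomain C'.carrier → trDeg k C.carrier ≤ trDeg k C'.carrier :=
    fun C' hC' => ht ▸ csInf_le (OrderBot.bddBelow S) ⟨C', hC', rfl⟩
  -- Replacing a minimal domain by the image of `D_k` in it makes it cyclic without raising the
  -- degree.
  obtain ⟨g⟩ := C.nonempty_hom_of_D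
  have hdom := g.kerLift_injective.isDomain g.kerLift.toAlgHom.toRingHom
  have := C.finiteType
  obtain ⟨δ, hδ⟩ := ENat.ne_top_iff_exists.1 (trDeg_ne_top (k := k) (A := C.carrier))
  refine ⟨δ, ⟨_, ⟨g.kerProj, g.kerProj_surjective⟩, hdom, ?_⟩, fun C' hC' => hδ ▸ hmin C' hC'⟩
  rw [hδ]
  exact le_antisymm (trDeg_le_of_injective _ g.kerLift_injective) (hmin _ hdom)

theorem ringKrullDim_eq_natCast {C : Ts k G} (hC : IsDomain C.carrier) {d : ℕ}
    (h : trDeg k C.carrier = d) : ringKrullDim C.carrier = d := by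
  have := C.finiteType
  rw [ringKrullDim_eq_trDeg (k := k), h]
  rfl

theorem isLeast_ringKrullDim {P : Ts k G → Prop} {δ : ℕ}
    (h1 : ∃ C : Ts k G, P C ∧ IsDomain C.carrier ∧ trDeg k C.carrier = δ)
    (h2 : ∀ C : Ts k G, IsDomain C.carrier → δ ≤ trDeg k C.carrier) :
    IsLeast {m : WithBot ℕ∞ | ∃ C : Ts k G, P C ∧ IsDomain C.carrier ∧
      ringKrullDim C.carrier = m} δ := by
  obtain ⟨C, hP, hC, hδ⟩ := h1
  refine ⟨⟨C, hP, hC, ringKrullDim_eq_natCast hC hδ⟩, ?_⟩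
  rintro _ ⟨C', -, hC', rfl⟩
  have := C'.finiteType
  rw [ringKrullDim_eq_trDeg (k := k)]
  exact WithBot.coe_le_coe.2 (h2 C' hC')

end Universal

/-! ### Essential dimension through universal algebras -/

section Main

variable {k G : Type u} [Field k] [Group G] [Fintype G] {U : Ts k G}

/-- The trivial group is treated apart because `K` may then be finite; its only point is `1`. -/
theorem EmbedsInD.specializes (hU : EmbedsInD U) {K : Type*} [Field K] [Algebra k K]
    {τ : G →* (K ≃ₐ[k] K)} (hτ : Function.Injective τ) (hK : Nontrivial G → Infinite K) :
    Specializes (fracAct U.act) τ := by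
  have := hU.isDomain
  cases subsingleton_or_nontrivial G
  · exact specializes_of_subsingleton _ _
  · have := hK inferInstance
    obtain ⟨j, hj, -⟩ := hU.exists_embedding
    exact (isDense_regAct hτ).specializes.of_isEquivariant hj

theorem specializes_fracAct_symAct {W : Type*} [AddCommGroup W] [Module k W] [Module.Finite k W]
    (ρ : Representation k G W) {K : Type*} [Field K] [Algebra k K] {τ : G →* (K ≃ₐ[k] K)}
    (hτ : Function.Injective τ) (hK : Nontrivial G → Infinite K) :
    Specializes (fracAct (symAct ρ)) τ := by
  cases subsingleton_or_nontrivial G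
  · exact specializes_of_subsingleton _ _
  · have := hK inferInstance
    exact (isDense_symAct ρ hτ).specializes

variable {p n : ℕ} [Fact p.Prime] [CharP k p]

theorem Ts.act_injective (hG : Nat.card G = p ^ n) (A : Ts k G) [Nontrivial A.carrier] :
    Function.Injective A.act :=
  A.exists_isPoint.choose_spec.injective hG

theorem StablePrime.resAct_injective (hG : Nat.card G = p ^ n) (P : StablePrime U) :
    Function.Injective P.resAct := by
  have := P.isPrime
  have h := Ideal.Quotient.isDomain P.ideal
  obtain ⟨b, hb⟩ := U.exists_isPoint
  exact fracAct_injective ((hb.map (isEquivariant_quotient_mk U.act P.ideal P.stable)).injective hG)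

/-- Degree zero would give an algebraic orbit algebra with faithful action inside a rational
function field. This is what makes essential fields infinite when `G` is nontrivial. -/
theorem EmbedsInD.essDimField_ne_zero (hG : Nat.card G = p ^ n) [Nontrivial G] (hU : EmbedsInD U) :
    essDimField (fracAct U.act) ≠ 0 := by
  have := hU.isDomain
  intro h0
  obtain ⟨b, hb, hle⟩ := exists_isPoint_trDeg_le (Field.toIsField (FractionRing U.carrier))
    (fracAct_injective (U.act_injective hG))
  rw [h0, nonpos_iff_eq_zero] at hle
  obtain ⟨j, -, hj⟩ := hU.exists_embedding
  have hs := (isEquivariant_orbitHom (fracAct U.act) b).range_stable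
  have hpt : IsPoint (subAct _ _ hs) ⟨b, MvPolynomial.X 1, by simp⟩ :=
    IsPoint.of_map (isEquivariant_val _ _ hs) Subtype.val_injective hb
  refine not_isAlgebraic_of_embedding (hpt.injective hG) (j.comp (Subalgebra.val _))
    (hj.comp Subtype.val_injective) ?_
  exact trdeg_eq_zero_iff.1 (by simpa [trDeg] using hle)

theorem EmbedsInD.infinite_fractionRing (hG : Nat.card G = p ^ n) [Nontrivial G] (hU : EmbedsInD U) :
    Infinite (FractionRing U.carrier) := by
  have := hU.isDomain
  obtain ⟨j, -, hj⟩ := hU.exists_embedding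
  exact infinite_of_not_isAlgebraic
    (not_isAlgebraic_of_embedding (fracAct_injective (U.act_injective hG)) j hj)

theorem isEssential_of_mem_embeddedPrimes (hG : Nat.card G = p ^ n) [IsDomain U.carrier]
    {P : StablePrime U}
    (hP : P ∈ embeddedPrimes U) (h : trDeg k P.ResField ≤ essDimField (fracAct U.act)) :
    IsEssential (essDimField (fracAct U.act)) P.resAct := by
  obtain ⟨φ, hφ, he⟩ := hP
  have := P.isPrime
  have := Ideal.Quotient.isDomain P.ideal
  have h1 : essDimField (fracAct U.act) ≤ essDimField P.resAct :=
    essDimField_le_of_isEquivariant he hφ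
  have h2 := essDimField_le_trDeg (Field.toIsField P.ResField) (P.resAct_injective hG)
  exact ⟨Field.toIsField _, P.resAct_injective hG, le_antisymm h (h1.trans h2),
    le_antisymm (h2.trans h) h1⟩

theorem essDimField_le_trDeg_resField (hG : Nat.card G = p ^ n) {P : StablePrime U}
    (hP : P ∈ embeddedPrimes U) :
    essDimField (fracAct U.act) ≤ trDeg k P.ResField := by
  obtain ⟨φ, hφ, he⟩ := hP
  have := P.isPrime
  have := Ideal.Quotient.isDomain P.ideal
  exact (essDimField_le_of_isEquivariant he hφ).trans
    (essDimField_le_trDeg (Field.toIsField P.ResField) (P.resAct_injective hG))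

theorem StablePrime.exists_embedding (P : StablePrime U) {K : Type*} [Field K] [Algebra k K]
    {τ : G →* (K ≃ₐ[k] K)} {f : U.carrier →ₐ[k] K} (hf : IsEquivariant U.act τ f)
    (hk : RingHom.ker f = P.ideal) :
    ∃ j : P.ResField →ₐ[k] K, Function.Injective j ∧ IsEquivariant P.resAct τ j := by
  obtain ⟨I, hI, hs⟩ := P
  obtain rfl : RingHom.ker f = I := hk
  have : IsDomain (U.carrier ⧸ RingHom.ker f) := Ideal.Quotient.isDomain _
  exact ⟨_, (fracLift _ (Ideal.kerLiftAlg_injective f)).injective,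
    (isEquivariant_kerLift hf).fracLift (Ideal.kerLiftAlg_injective f)⟩

/-- For every field `K` to which the total ring of quotients of `U` specializes and whose
transcendence degree and essential dimension agree with that of `U`, there is an essential
residue field of `U` embedding into both. -/
theorem exists_mem_embeddedPrimes (hG : Nat.card G = p ^ n) (hU : IsUniversal U) (hUD : EmbedsInD U)
    {K : Type*} [Field K] [Algebra k K] {τ : G →* (K ≃ₐ[k] K)} (hspec : Specializes (fracAct U.act) τ)
    (hK : essDimField (fracAct U.act) ≤ essDimField τ) :
    ∃ P ∈ embeddedPrimes U, IsEssential (essDimField (fracAct U.act)) P.resAct ∧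
      ∃ j : P.ResField →ₐ[k] K, Function.Injective j ∧ IsEquivariant P.resAct τ j := by
  have := hUD.isDomain
  obtain ⟨b, hb, hle⟩ := exists_isPoint_trDeg_le (Field.toIsField (FractionRing U.carrier))
    (fracAct_injective (U.act_injective hG))
  obtain ⟨c, hc, hbc⟩ := hspec b hb
  obtain ⟨f⟩ := isUniversal_iff.1 hU
  let fb := (pointHom hb).comp f.toAlgHom
  let fc := (pointHom hc).comp f.toAlgHom
  have hfb : IsEquivariant U.act (fracAct U.act) fb :=
    (isEquivariant_pointHom hb).comp f.isEquivariant
  have hfc : IsEquivariant U.act τ fc := (isEquivariant_pointHom hc).comp f.isEquivariant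
  have hker : RingHom.ker fb ≤ RingHom.ker fc := fun x hx => by
    obtain ⟨P, hP⟩ := Ideal.Quotient.mk_surjective (f.toAlgHom x)
    change pointHom hb (f.toAlgHom x) = 0 at hx
    change pointHom hc (f.toAlgHom x) = 0
    rw [← hP, pointHom_mk] at hx ⊢
    exact hbc hx
  have hbp : (RingHom.ker fb).IsPrime := RingHom.ker_isPrime fb.toRingHom
  have hcp : (RingHom.ker fc).IsPrime := RingHom.ker_isPrime fc.toRingHom
  have hrange : fb.range ≤ (orbitHom (fracAct U.act) b).range := by
    rintro _ ⟨x, rfl⟩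
    obtain ⟨P, hP⟩ := Ideal.Quotient.mk_surjective (f.toAlgHom x)
    refine ⟨P, ?_⟩
    change _ = pointHom hb (f.toAlgHom x)
    rw [← hP]
    rfl
  have htb : trDeg k (U.carrier ⧸ RingHom.ker fb) ≤ essDimField (fracAct U.act) :=
    (trDeg_quotient_ker_le hrange).trans hle
  have htc : essDimField τ ≤ trDeg k (U.carrier ⧸ RingHom.ker fc) := by
    obtain ⟨a, ha⟩ := U.exists_isPoint
    exact essDimField_le_of_ker hG hfc ⟨a, ha.map hfc⟩
  have := Ideal.Quotient.isDomain (RingHom.ker fb)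
  have := Ideal.Quotient.isDomain (RingHom.ker fc)
  have := U.finiteType
  -- The quotient for `b` has degree at most `e_k(Q(U))`, the one for `c` at least `e_k(K)`; the
  -- surjection between them cannot lose dimension.
  have hinj := injective_of_surjective_of_trDeg_le (Ideal.Quotient.factorₐ k hker)
    (Ideal.Quotient.factor_surjective hker) (htb.trans (hK.trans htc))
  have heq : RingHom.ker fc = RingHom.ker fb := le_antisymm (fun x hx => by
    refine Ideal.Quotient.eq_zero_iff_mem.1 (hinj ?_)
    rw [map_zero]
    exact Ideal.Quotient.eq_zero_iff_mem.2 hx) hker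
  let P : StablePrime U := ⟨RingHom.ker fb, hbp, hfb.ker_stable⟩
  obtain ⟨φ, hφ, hφe⟩ := P.exists_embedding hfb rfl
  have hP : P ∈ embeddedPrimes U := ⟨φ, hφ, hφe⟩
  refine ⟨P, hP, isEssential_of_mem_embeddedPrimes hG hP ?_, P.exists_embedding hfc heq⟩
  exact (trDeg_fractionRing (A := U.carrier ⧸ RingHom.ker fb)).trans_le htb

variable {V : Type v} [AddCommGroup V] [Module k V] [Module.Finite k V] {ρ : Representation k G V}

theorem essDim_eq_essDimField (hG : Nat.card G = p ^ n) (hρ : Function.Injective ρ) (hUD : EmbedsInD U) :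
    essDim ρ = essDimField (fracAct U.act) := by
  have := hUD.isDomain
  have hV := fracAct_symAct_dual_injective hρ
  have hU := fracAct_injective (U.act_injective hG)
  exact le_antisymm
    (essDimField_le_of_specializes hG (Field.toIsField (FractionRing U.carrier)) hU
      (hUD.specializes hV fun _ => infinite_fractionRing_symmetricAlgebra hρ))
    (essDimField_le_of_specializes hG
      (Field.toIsField (FractionRing (SymmetricAlgebra k (Module.Dual k V)))) hV
      (specializes_fracAct_symAct ρ.dual hU fun _ => hUD.infinite_fractionRing hG))

theorem essDim_le_trDeg (hG : Nat.card G = p ^ n) (hρ : Function.Injective ρ) (hU : IsUniversal U) :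
    essDim ρ ≤ trDeg k U.carrier := by
  obtain ⟨b, hb⟩ := exists_isPoint (fracAct (symAct ρ.dual))
    (Field.toIsField (FractionRing (SymmetricAlgebra k (Module.Dual k V))))
    (fracAct_symAct_dual_injective hρ)
  obtain ⟨f, hf⟩ := hU.exists_hom hb
  obtain ⟨a, ha⟩ := U.exists_isPoint
  exact (essDimField_le_of_ker hG hf ⟨a, ha.map hf⟩).trans
    (trDeg_le_of_surjective (Ideal.Quotient.mkₐ k _) Ideal.Quotient.mk_surjective)

/-- The orbit algebra of an optimal point of `k(V*)` is itself such a domain, realized as a quotient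
of `D_k`. -/
theorem exists_isDomain_trDeg_le_essDim (hρ : Function.Injective ρ) :
    ∃ C : Ts k G, IsDomain C.carrier ∧ trDeg k C.carrier ≤ essDim ρ := by
  obtain ⟨b, hb, hle⟩ := exists_isPoint_trDeg_le
    (Field.toIsField (FractionRing (SymmetricAlgebra k (Module.Dual k V))))
    (fracAct_symAct_dual_injective hρ)
  have hp : (RingHom.ker (pointHom hb)).IsPrime := RingHom.ker_isPrime (pointHom hb).toRingHom
  refine ⟨(Ts.D k G).quot (RingHom.ker (pointHom hb)) (isEquivariant_pointHom hb).ker_stable,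
    Ideal.Quotient.isDomain (RingHom.ker (pointHom hb)), le_trans ?_ hle⟩
  refine trDeg_quotient_ker_le (f := pointHom hb) ?_
  rintro _ ⟨x, rfl⟩
  obtain ⟨P, rfl⟩ := Ideal.Quotient.mk_surjective x
  exact ⟨P, rfl⟩

end Main

end

end TraceSurj

open TraceSurj in
theorem theorem0p11 {k G : Type u} [Field k] [Group G] [Fintype G] (p n : ℕ) [Fact p.Prime]
    [CharP k p] (hG : Nat.card G = p ^ n) :
    ∃ d δ : ℕ,
      -- basic objects exist; they are domains of the common Krull dimension `d = d_k(G)`,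
      -- and embed into `D_k`
      (∃ B : Ts k G, IsBasic B) ∧
      (∀ B : Ts k G, IsBasic B →
        IsDomain B.carrier ∧ ringKrullDim B.carrier = d ∧ EmbedsInD B) ∧
      -- `δ = d_{dom,k}(G)`, as a minimum over all domains and over all cyclic domains
      IsLeast {m : WithBot ℕ∞ | ∃ C : Ts k G, IsDomain C.carrier ∧ ringKrullDim C.carrier = m} δ ∧
      IsLeast {m : WithBot ℕ∞ | ∃ C : Ts k G, IsCyclicTs C ∧ IsDomain C.carrier ∧
        ringKrullDim C.carrier = m} δ ∧
      d ≤ n ∧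
      -- `e_k(G) = essDim ρ` for any faithful finite-dimensional representation `ρ`
      ∀ (V : Type v) [AddCommGroup V] [Module k V] [Module.Finite k V] (ρ : Representation k G V),
        Function.Injective ρ →
        essDim ρ ≤ d ∧ (δ : ℕ∞) ≤ essDim ρ ∧
        ∀ U : Ts k G, IsUniversal U → EmbedsInD U →
          essDim ρ = essDimField (fracAct U.act) ∧
          IsLeast {t : ℕ∞ | ∃ P ∈ embeddedPrimes U, trDeg k P.ResField = t} (essDim ρ) ∧
          (∃ P ∈ embeddedPrimes U, IsEssential (essDim ρ) P.resAct) ∧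
          ∀ (K : Type w) [Field K] [Algebra k K] (σ : G →* (K ≃ₐ[k] K)),
            IsEssential (essDim ρ) σ →
            ∃ P ∈ embeddedPrimes U, IsEssential (essDim ρ) P.resAct ∧
              ∃ j : P.ResField →ₐ[k] K,
                (∀ (g : G) (x : P.ResField), j (P.resAct g x) = σ g (j x)) ∧
                Algebra.IsAlgebraic j.range K := by
  obtain ⟨d, ⟨U₀, hU₀, hU₀D, hd⟩, hmin⟩ := exists_isUniversal_minimal k G
  obtain ⟨δ, ⟨C₀, hC₀, hC₀dom, hδ⟩, hδmin⟩ := exists_isDomain_minimal k G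
  obtain ⟨U₁, hU₁, hU₁D, hn⟩ := exists_isUniversal_trDeg_le (k := k) hG
  refine ⟨d, δ, ⟨U₀, isBasic_of_trDeg_le hU₀ hU₀D (hd ▸ hmin)⟩, fun B hB => ?_, ?_,
    isLeast_ringKrullDim ⟨C₀, hC₀, hC₀dom, hδ⟩ hδmin, by exact_mod_cast (hmin U₁ hU₁ hU₁D).trans hn,
    fun V _ _ _ ρ hρ => ?_⟩
  · have hBD := hB.embedsInD
    refine ⟨hBD.isDomain, ringKrullDim_eq_natCast hBD.isDomain (le_antisymm ?_ ?_), hBD⟩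
    · exact hd ▸ hB.trDeg_le hU₀
    · exact hmin B hB.1 hBD
  · simpa using isLeast_ringKrullDim (P := fun _ => True) ⟨C₀, trivial, hC₀dom, hδ⟩ hδmin
  have hed : essDim ρ ≤ d := hd ▸ essDim_le_trDeg hG hρ hU₀
  refine ⟨hed, ?_, fun U hU hUD => ?_⟩
  · obtain ⟨C, hC, hle⟩ := exists_isDomain_trDeg_le_essDim hρ
    exact (hδmin C hC).trans hle
  have heq := essDim_eq_essDimField hG hρ hUD
  have := hUD.isDomain
  have hUinj := fracAct_injective (U.act_injective hG)
  -- Taking `K` to be `Q(U)` itself already yields an essential residue field.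
  obtain ⟨P, hP, hPe, -⟩ := exists_mem_embeddedPrimes hG hU hUD
    (hUD.specializes hUinj fun _ => hUD.infinite_fractionRing hG) le_rfl
  rw [← heq] at hPe
  refine ⟨heq, ⟨⟨P, hP, hPe.trDeg_eq⟩, ?_⟩, ⟨P, hP, hPe⟩, fun K _ _ σ hσ => ?_⟩
  · rintro _ ⟨P', hP', rfl⟩
    exact heq ▸ essDimField_le_trDeg_resField hG hP'
  have hKinf : Nontrivial G → Infinite K := fun _ => infinite_of_not_isAlgebraic (k := k) fun hK =>
    hUD.essDimField_ne_zero hG (by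
      rw [← heq, ← hσ.trDeg_eq, trDeg, trdeg_eq_zero, map_zero])
  obtain ⟨P', hP', hPe', j, hj, hje⟩ := exists_mem_embeddedPrimes hG hU hUD
    (hUD.specializes hσ.faithful hKinf) (by rw [← heq, hσ.essDimField_eq])
  rw [← heq] at hPe'
  refine ⟨P', hP', hPe', j, hje, isAlgebraic_range_of_trDeg_eq j hj ?_ ?_⟩
  · rw [hPe'.trDeg_eq, hσ.trDeg_eq]
  · rw [hσ.trDeg_eq]
    exact ne_top_of_le_ne_top (ENat.natCast_ne_top d) hed
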